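/- Let $A\in\mathbb R^{n\times n}$, $B\in\mathbb R^{n\times l}$, $E\in\mathbb R^{n\times m}$, $z\in\mathbb R^n$ with $(A,B)$ stabilizable, and let $\{W(k)\}_{k\in\mathbb N_0}$ be i.i.d. square-integrable $\mathbb R^m$-valued random variables with mean $\mu_W$ on a probability space $(\Omega,\mathcal F,\mathbb P)$. Consider $$X(k+1)=f(X(k),U(k),W(k)):=AX(k)+BU(k)+EW(k)+z,\qquad X(0)=X_0\in L^2 ,$$ with solution $X_U(\cdot,X_0)$. The control processes are those for which $U(k)\in L^2$ is measurable (up to null sets) with respect to $\sigma(X(0),\dots,X(k))$ and $W(k)$ is independent of $X(k)$ and of $U(k)$, for all $k=0,\dots,N-1$. Let $Q_1,Q_2,R_2\ge 0$ and $R_1>0$ be symmetric, $s\in\mathbb R^n$, $v\in\mathbb R^l$, $c\in\mathbb R$, and put $$\ell(X,U):=\mathbb E[X^TQ_1X+U^TR_1U+s^TX+v^TU+c]+\mathrm{Tr}(Q_2\,\mathrm{Cov}(X))+\mathrm{Tr}(R_2\,\mathrm{Cov}(U)),\qquad J_N(X_0,U):=\sum_{k=0}^{N-1}\ell(X(k),U(k)).$$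 A pair of processes $(X^s(\cdot),U^s(\cdot))$ is called stationary if $X^s(k+1)=f(X^s(k),U^s(k),W(k))$, $W(k)$ is independent of $X^s(k)$ and of $U^s(k)$, and the laws of $X^s(k)$ and of $U^s(k)$ do not depend on $k$ and have finite second moments. Let $\mathcal K_\infty$ be the class of continuous, strictly increasing, unbounded $\alpha:[0,\infty)\to[0,\infty)$ with $\alpha(0)=0$. The problem is strictly dissipative in $L^2$ at $(X^s,U^s)$ with storage function $\lambda:\mathbb N_0\times L^2\to\mathbb R$ and rate $\alpha\in\mathcal K_\infty$ if $\lambda$ is bounded from below and $$\ell(X,U)-\ell(X^s(k),U^s(k))+\lambda(k,X)-\lambda(k+1,f(X,U,W(k)))\ \ge\ \alpha\big(\mathbb E\|X-X^s(k)\|^2\big)$$ for all $k\in\mathbb N_0$ and all $X,U\in L^2$ that are independent of $W(k)$. Let $W_2$ be the Wasserstein distance of order $2$ between laws (infimum of $\|\bar X-\bar Y\|_{L^2}$ over all couplings). Assume that $(x^s,u^s)$ solves $(I-A)x^s-Bu^s=E\mu_W+z$ and that $(A,Q_1^{1/2})$ is detectable. Then there exist a positive semidefinite solution $P$ of $$P=A^TPA+(Q_1+Q_2)-A^TPB[(R_1+R_2)+B^TPB]^{-1}B^TPA,$$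 a symmetric positive definite $S\in\mathbb R^{n\times n}$, $q\in\mathbb R^n$, a solution $(\tilde x,\tilde u)$ of $(I-A)\tilde x-B\tilde u=0$ and a function $\alpha$ such that, with $K:=-[(R_1+R_2)+B^TPB]^{-1}B^TPA$, the following holds. If $\Omega$ carries a uniformly distributed random variable that is independent of $\{W(k)\}_k$, then there is a stationary pair $(X^s_\star,U^s_\star)$ of the form $$U^s_\star(k)=K(X^s_\star(k)-\tilde x-x^s)+\tilde u+u^s .$$ For every stationary pair of this form: 1. The problem is strictly dissipative in $L^2$ at $(X^s_\star,U^s_\star)$ with rate $\alpha\in\mathcal K_\infty$ and storage function $$\lambda(k,X)=\mathbb E\big[\|X-(X^s_\star(k)-\tilde x)\|_{P+S}^2-\|X-x^s\|_P^2+q^T(X-(X^s_\star(k)-\tilde x))\big].$$ 2. (Turnpike in distribution.) For every $X_0\in L^2$ there is $C\in\mathbb R$ such that for every $\delta>0$, every $N$, every control process $U(\cdot)$ with $J_N(X_0,U)\le\delta+\sum_{k=0}^{N-1}\ell(X^s_\star(k),U^s_\star(k))$ and every $\varepsilon>0$, $$\mathcal D_\varepsilon:=\#\{k\in\{0,\dots,N-1\}: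 W_2(X_U(k,X_0),X^s_\star(k))\le\varepsilon\}\ \ge\ N-\frac{\delta+C}{\alpha(\sqrt\varepsilon)} .$$ 3. For every rate $\alpha'\in\mathcal K_\infty$ with which the problem is strictly dissipative in $L^2$ at $(X^s_\star,U^s_\star)$ for some storage function, the assertion of 2 holds with $\alpha'(\varepsilon^2)$ in place of $\alpha(\sqrt\varepsilon)$. -/

import Mathlib

open MeasureTheory ProbabilityTheory
open scoped ENNReal Matrix MatrixOrder

noncomputable section

namespace StochLQ

/-- Euclidean space `ℝⁿ`. -/
abbrev Vec (n : ℕ) : Type := EuclideanSpace ℝ (Fin n)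

/-- The quadratic form `xᵀ M x`, written `‖x‖²_M` when `M` is positive semidefinite. -/
def quad {n : ℕ} (M : Matrix (Fin n) (Fin n) ℝ) (x : Vec n) : ℝ :=
  inner ℝ x (M.toEuclideanLin x)

/-! ### Linear systems theory -/

/-- A real square matrix all of whose complex eigenvalues lie in the open unit disc. -/
def IsSchurStable {n : ℕ} (A : Matrix (Fin n) (Fin n) ℝ) : Prop :=
  ∀ ev ∈ spectrum ℂ (A.map (algebraMap ℝ ℂ)), ‖ev‖ < 1

def IsStabilizable {n l : ℕ} (A : Matrix (Fin n) (Fin n) ℝ) (B : Matrix (Fin n) (Fin l) ℝ) :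
    Prop :=
  ∃ F : Matrix (Fin l) (Fin n) ℝ, IsSchurStable (A + B * F)

def IsDetectable {n p : ℕ} (A : Matrix (Fin n) (Fin n) ℝ) (C : Matrix (Fin p) (Fin n) ℝ) :
    Prop :=
  ∃ L : Matrix (Fin n) (Fin p) ℝ, IsSchurStable (A + L * C)

/-- The data of the generalized stochastic linear-quadratic optimal control problem: the dynamics
`X⁺ = A X + B U + E W + z` and the coefficients of the stage cost. -/
structure Problem (n l m : ℕ) where
  A : Matrix (Fin n) (Fin n) ℝ
  B : Matrix (Fin n) (Fin l) ℝ
  E : Matrix (Fin n) (Fin m) ℝ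
  z : Vec n
  Q₁ : Matrix (Fin n) (Fin n) ℝ
  Q₂ : Matrix (Fin n) (Fin n) ℝ
  R₁ : Matrix (Fin l) (Fin l) ℝ
  R₂ : Matrix (Fin l) (Fin l) ℝ
  s : Vec n
  v : Vec l
  c : ℝ

/-- Class `𝒦_∞`; only the values on `[0, ∞)` matter. -/
structure IsKInfty (α : ℝ → ℝ) : Prop where
  continuousOn : ContinuousOn α (Set.Ici 0)
  strictMonoOn : StrictMonoOn α (Set.Ici 0)
  map_zero : α 0 = 0
  unbounded : ¬ BddAbove (α '' Set.Ici 0)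

/-- The Wasserstein distance of order `p`: the infimum of `‖X̄ - Ȳ‖_{L^p}` over all couplings
`(X̄, Ȳ)` of the two laws, a coupling being represented by its joint law. -/
def wasserstein {n : ℕ} (p : ℝ≥0∞) (ρ₁ ρ₂ : Measure (Vec n)) : ℝ≥0∞ :=
  ⨅ (π : Measure (Vec n × Vec n)) (_ : π.map Prod.fst = ρ₁ ∧ π.map Prod.snd = ρ₂),
    eLpNorm (fun q : Vec n × Vec n => q.1 - q.2) p π

variable {n l m : ℕ} {Ω : Type*} [MeasurableSpace Ω]

/-- Square-integrable random vectors. -/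
def IsL2 {d : ℕ} (μ : Measure Ω) (X : Ω → Vec d) : Prop :=
  Measurable X ∧ MemLp X 2 μ

/-- `𝒫₂(ℝᵈ)`. -/
def IsP2 {d : ℕ} (ρ : Measure (Vec d)) : Prop :=
  IsProbabilityMeasure ρ ∧ ∫⁻ x, ‖x‖ₑ ^ 2 ∂ρ < ∞

/-- The covariance matrix of a random vector. -/
def covMatrix {d : ℕ} (μ : Measure Ω) (X : Ω → Vec d) : Matrix (Fin d) (Fin d) ℝ :=
  Matrix.of fun i j => covariance (fun ω => X ω i) (fun ω => X ω j) μ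

/-- The noise: a sequence of i.i.d. square-integrable random vectors. -/
structure IsNoise (μ : Measure Ω) (W : ℕ → Ω → Vec m) : Prop where
  isL2 : ∀ k, IsL2 μ (W k)
  indep : iIndepFun W μ
  ident : ∀ k, IdentDistrib (W k) (W 0) μ μ

namespace Problem

variable (S : Problem n l m)

/-- The stage cost `ℓ(X, U)` of a pair of random vectors. -/
def stageCost (μ : Measure Ω) (X : Ω → Vec n) (U : Ω → Vec l) : ℝ :=
  (∫ ω, (quad S.Q₁ (X ω) + quad S.R₁ (U ω) + inner ℝ S.s (X ω) + inner ℝ S.v (U ω) + S.c) ∂μ)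
    + ((S.Q₂ * covMatrix μ X).trace + (S.R₂ * covMatrix μ U).trace)

/-- The dynamics `f(X, U, W) = A X + B U + E W + z`. -/
def step (X : Ω → Vec n) (U : Ω → Vec l) (W : Ω → Vec m) : Ω → Vec n := fun ω =>
  S.A.toEuclideanLin (X ω) + S.B.toEuclideanLin (U ω) + S.E.toEuclideanLin (W ω) + S.z

/-- The solution `X_U(·, X₀)`. -/
def traj (W : ℕ → Ω → Vec m) (X₀ : Ω → Vec n) (U : ℕ → Ω → Vec l) : ℕ → Ω → Vec n
  | 0 => X₀
  | k + 1 => S.step (traj W X₀ U k) (U k) (W k)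

/-- The cost functional `J_N(X₀, U)`. -/
def totalCost (μ : Measure Ω) (W : ℕ → Ω → Vec m) (N : ℕ) (X₀ : Ω → Vec n)
    (U : ℕ → Ω → Vec l) : ℝ :=
  ∑ k ∈ Finset.range N, S.stageCost μ (S.traj W X₀ U k) (U k)

/-- The `σ`-algebra `σ(X(0), …, X(k))` generated by the state process. -/
abbrev stateSigma (W : ℕ → Ω → Vec m) (X₀ : Ω → Vec n) (U : ℕ → Ω → Vec l) (k : ℕ) :
    MeasurableSpace Ω :=
  ⨆ j ∈ Finset.range (k + 1), MeasurableSpace.comap (S.traj W X₀ U j) inferInstance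

/-- Control processes on the horizon `N`: `U(k)` is square integrable and, up to null sets,
measurable with respect to `σ(X(0), …, X(k))`, and the noise `W(k)` is independent of `X(k)` and
of `U(k)`. -/
structure IsControl (μ : Measure Ω) (W : ℕ → Ω → Vec m) (N : ℕ) (X₀ : Ω → Vec n)
    (U : ℕ → Ω → Vec l) : Prop where
  isL2 : ∀ k < N, IsL2 μ (U k)
  adapted : ∀ k < N, AEStronglyMeasurable[S.stateSigma W X₀ U k] (U k) μ
  indep_state : ∀ k < N, IndepFun (W k) (S.traj W X₀ U k) μ
  indep_control : ∀ k < N, IndepFun (W k) (U k) μ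

/-- Stationary pairs of state and control processes. -/
structure IsStationaryPair (μ : Measure Ω) (W : ℕ → Ω → Vec m) (Xs : ℕ → Ω → Vec n)
    (Us : ℕ → Ω → Vec l) : Prop where
  measurable_state : ∀ k, Measurable (Xs k)
  measurable_control : ∀ k, Measurable (Us k)
  indep_state : ∀ k, IndepFun (W k) (Xs k) μ
  indep_control : ∀ k, IndepFun (W k) (Us k) μ
  law_state : ∃ ρ : Measure (Vec n), IsP2 ρ ∧ ∀ k, μ.map (Xs k) = ρ
  law_control : ∃ ρ : Measure (Vec l), IsP2 ρ ∧ ∀ k, μ.map (Us k) = ρ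
  dynamics : ∀ k, Xs (k + 1) = S.step (Xs k) (Us k) (W k)

/-- Strict dissipativity in `L²` at `(Xs, Us)` with storage function `lam` and rate `α`. The
inequality is required for all square-integrable `X`, `U` that are independent of `W(k)`. -/
structure IsStrictlyDissipative (μ : Measure Ω) (W : ℕ → Ω → Vec m) (Xs : ℕ → Ω → Vec n)
    (Us : ℕ → Ω → Vec l) (lam : ℕ → (Ω → Vec n) → ℝ) (α : ℝ → ℝ) : Prop where
  isKInfty : IsKInfty α
  bddBelow : ∃ M : ℝ, ∀ k X, IsL2 μ X → M ≤ lam k X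
  ineq : ∀ k X U, IsL2 μ X → IsL2 μ U → IndepFun (W k) X μ → IndepFun (W k) U μ →
    α (∫ ω, ‖X ω - Xs k ω‖ ^ 2 ∂μ) ≤
      S.stageCost μ X U - S.stageCost μ (Xs k) (Us k) + lam k X - lam (k + 1) (S.step X U (W k))

/-- `P` is a positive semidefinite solution of the discrete-time algebraic Riccati equation. -/
def IsRiccatiSolution (P : Matrix (Fin n) (Fin n) ℝ) : Prop :=
  P.PosSemidef ∧
    P = S.Aᵀ * P * S.A + (S.Q₁ + S.Q₂)
      - S.Aᵀ * P * S.B * ((S.R₁ + S.R₂) + S.Bᵀ * P * S.B)⁻¹ * S.Bᵀ * P * S.A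

/-- The gain `K = -[(R₁ + R₂) + Bᵀ P B]⁻¹ Bᵀ P A`. -/
def gain (P : Matrix (Fin n) (Fin n) ℝ) : Matrix (Fin l) (Fin n) ℝ :=
  -(((S.R₁ + S.R₂) + S.Bᵀ * P * S.B)⁻¹ * S.Bᵀ * P * S.A)

/-- A stationary pair that is generated by the feedback
`U(k) = K (X(k) - x̃ - xs) + ũ + us`. -/
def IsFeedbackStationaryPair (μ : Measure Ω) (W : ℕ → Ω → Vec m) (P : Matrix (Fin n) (Fin n) ℝ)
    (xs xt : Vec n) (us ut : Vec l) (Xs : ℕ → Ω → Vec n) (Us : ℕ → Ω → Vec l) : Prop :=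
  S.IsStationaryPair μ W Xs Us ∧
    ∀ k ω, Us k ω = (S.gain P).toEuclideanLin (Xs k ω - xt - xs) + ut + us

/-- `D_ε`: the number of times `k < N` at which the Wasserstein distance of order two between the
laws of `X_U(k, X₀)` and `Xs(k)` is at most `ε`. -/
def closeTimes (μ : Measure Ω) (W : ℕ → Ω → Vec m) (Xs : ℕ → Ω → Vec n) (N : ℕ)
    (X₀ : Ω → Vec n) (U : ℕ → Ω → Vec l) (ε : ℝ) : ℕ :=
  Set.ncard {k : ℕ | k < N ∧
    wasserstein 2 (μ.map (S.traj W X₀ U k)) (μ.map (Xs k)) ≤ ENNReal.ofReal ε}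

/-- The turnpike property in distribution at `(Xs, Us)`, where the number of times `k < N` at which
the distance exceeds `ε` is at most `(δ + C) / β ε`. The constant `C` depends on `X₀` only. -/
def TurnpikeInDistribution (μ : Measure Ω) (W : ℕ → Ω → Vec m) (Xs : ℕ → Ω → Vec n)
    (Us : ℕ → Ω → Vec l) (β : ℝ → ℝ) : Prop :=
  ∀ X₀ : Ω → Vec n, IsL2 μ X₀ →
    ∃ C : ℝ, ∀ δ : ℝ, 0 < δ → ∀ (N : ℕ) (U : ℕ → Ω → Vec l), S.IsControl μ W N X₀ U →
      S.totalCost μ W N X₀ U ≤ δ + ∑ k ∈ Finset.range N, S.stageCost μ (Xs k) (Us k) →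
      ∀ ε : ℝ, 0 < ε → (N : ℝ) - (δ + C) / β ε ≤ (S.closeTimes μ W Xs N X₀ U ε : ℝ)

end Problem

/-- The storage function
`λ(k, X) = E[‖X - (Xs(k) - x̃)‖²_{P + T} - ‖X - xs‖²_P + qᵀ (X - (Xs(k) - x̃))]`. -/
def storage (μ : Measure Ω) (P T : Matrix (Fin n) (Fin n) ℝ) (q xs xt : Vec n)
    (Xs : ℕ → Ω → Vec n) (k : ℕ) (X : Ω → Vec n) : ℝ :=
  ∫ ω, (quad (P + T) (X ω - (Xs k ω - xt)) - quad P (X ω - xs)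
    + inner ℝ q (X ω - (Xs k ω - xt))) ∂μ

/-- The probability space carries a uniformly distributed random variable that is independent of
the noise sequence. -/
def CarriesIndependentUniform (μ : Measure Ω) (W : ℕ → Ω → Vec m) : Prop :=
  ∃ ξ : Ω → ℝ, Measurable ξ ∧ μ.map ξ = volume.restrict (Set.Icc (0 : ℝ) 1) ∧
    IndepFun ξ (fun ω k => W k ω) μ

end StochLQ

end

/-!
Detectability provides, through the matrix certifying the stability of the output-injected system,
a matrix `T > 0` such that the cost plus the decrease of `‖·‖²_T` along the deterministic dynamics
dominates a multiple of `‖x‖² + ‖u‖²`; adding a Lagrange multiplier `q` of the cheapest steady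
state `(x̃, ũ)` (relative to `(x^s, u^s)`) handles the linear terms of the cost. Stabilizability
bounds the monotone value iteration started at `0`, whose limit is `P`.

Write `X = D + Y` with `Y(k) = X^s(k) - x̃ - x^s` the fluctuation of the stationary state, which
follows the closed loop of the Riccati gain. In the expected cost along the dynamics the products
of `D` and `Y` cancel against `‖·‖²_P` because of the Riccati equation, the noise drops out of `D`,
and what remains is the deterministic estimate for `D`. Summing it along a trajectory
telescopes the storage function, and an almost optimal cost therefore leaves room for only
`(δ + C) / α(√ε)` times at which `X` is far from `X^s` in `L²`, hence in the distance `W₂`.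

With `G` the stable closed-loop matrix, the stationary law is that of `∑ Gʲ v_j` for independent
copies `v_j` of the centred noise `E (W - μ_W)`; the independent uniform variable realizes
this law at time `0` independently of the noise, and the dynamics preserve it.
-/

namespace StochLQ

/-! ### Quadratic forms -/

section Quad

open scoped Matrix.Norms.L2Operator

variable {a b d : ℕ}

theorem toEuclideanLin_mul_apply (A : Matrix (Fin a) (Fin b) ℝ) (B : Matrix (Fin b) (Fin d) ℝ)
    (x : Vec d) : (A * B).toEuclideanLin x = A.toEuclideanLin (B.toEuclideanLin x) := by
  rw [Matrix.toLpLin_mul_same, LinearMap.comp_apply]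

theorem toEuclideanLin_add_mul_apply (A : Matrix (Fin a) (Fin d) ℝ) (B : Matrix (Fin a) (Fin b) ℝ)
    (K : Matrix (Fin b) (Fin d) ℝ) (x : Vec d) :
    (A + B * K).toEuclideanLin x =
      A.toEuclideanLin x + B.toEuclideanLin (K.toEuclideanLin x) := by
  rw [map_add, LinearMap.add_apply, toEuclideanLin_mul_apply]

theorem norm_toEuclideanLin_le (A : Matrix (Fin a) (Fin b) ℝ) (x : Vec b) :
    ‖A.toEuclideanLin x‖ ≤ ‖A‖ * ‖x‖ :=
  A.l2_opNorm_mulVec x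

theorem inner_transpose (A : Matrix (Fin a) (Fin b) ℝ) (x : Vec b) (y : Vec a) :
    inner ℝ x (Aᵀ.toEuclideanLin y) = inner ℝ (A.toEuclideanLin x) y := by
  rw [← Matrix.conjTranspose_eq_transpose_of_trivial,
    Matrix.toEuclideanLin_conjTranspose_eq_adjoint, LinearMap.adjoint_inner_right]

theorem inner_toEuclideanLin_comm {M : Matrix (Fin d) (Fin d) ℝ} (hM : M.IsHermitian)
    (x y : Vec d) : inner ℝ x (M.toEuclideanLin y) = inner ℝ y (M.toEuclideanLin x) := by
  rw [← Matrix.isSymmetric_toEuclideanLin_iff.2 hM, real_inner_comm]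

theorem quad_add_vec {M : Matrix (Fin d) (Fin d) ℝ} (hM : M.IsHermitian) (x y : Vec d) :
    quad M (x + y) = quad M x + 2 * inner ℝ x (M.toEuclideanLin y) + quad M y := by
  simp only [quad, map_add, inner_add_left, inner_add_right]
  rw [inner_toEuclideanLin_comm hM y x]
  ring

theorem quad_smul_vec (M : Matrix (Fin d) (Fin d) ℝ) (r : ℝ) (x : Vec d) :
    quad M (r • x) = r ^ 2 * quad M x := by
  simp only [quad, map_smul, inner_smul_left, inner_smul_right, RCLike.conj_to_real]
  ring

theorem quad_neg_vec (M : Matrix (Fin d) (Fin d) ℝ) (x : Vec d) : quad M (-x) = quad M x := by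
  simp [quad]

theorem quad_sub_vec {M : Matrix (Fin d) (Fin d) ℝ} (hM : M.IsHermitian) (x y : Vec d) :
    quad M (x - y) = quad M x - 2 * inner ℝ x (M.toEuclideanLin y) + quad M y := by
  rw [sub_eq_add_neg, quad_add_vec hM, quad_neg_vec, map_neg, inner_neg_right]
  ring

theorem quad_add (M N : Matrix (Fin d) (Fin d) ℝ) (x : Vec d) :
    quad (M + N) x = quad M x + quad N x := by
  simp [quad, inner_add_right]

theorem quad_sub (M N : Matrix (Fin d) (Fin d) ℝ) (x : Vec d) :
    quad (M - N) x = quad M x - quad N x := by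
  simp [quad, inner_sub_right]

theorem quad_smul (r : ℝ) (M : Matrix (Fin d) (Fin d) ℝ) (x : Vec d) :
    quad (r • M) x = r * quad M x := by
  simp [quad, inner_smul_right]

theorem quad_sum {ι : Type*} (s : Finset ι) (M : ι → Matrix (Fin d) (Fin d) ℝ) (x : Vec d) :
    quad (∑ i ∈ s, M i) x = ∑ i ∈ s, quad (M i) x := by
  simp [quad, inner_sum]

theorem quad_transpose_mul_mul (M : Matrix (Fin a) (Fin a) ℝ) (A : Matrix (Fin a) (Fin d) ℝ)
    (x : Vec d) : quad (Aᵀ * M * A) x = quad M (A.toEuclideanLin x) := by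
  rw [quad, toEuclideanLin_mul_apply, toEuclideanLin_mul_apply, inner_transpose, quad]

theorem quad_transpose_mul_self (A : Matrix (Fin a) (Fin d) ℝ) (x : Vec d) :
    quad (Aᵀ * A) x = ‖A.toEuclideanLin x‖ ^ 2 := by
  rw [quad, toEuclideanLin_mul_apply, inner_transpose, real_inner_self_eq_norm_sq]

theorem quad_eq_dotProduct (M : Matrix (Fin d) (Fin d) ℝ) (x : Vec d) :
    quad M x = star x.ofLp ⬝ᵥ (M *ᵥ x.ofLp) := by
  simp [quad, Matrix.toLpLin_apply, EuclideanSpace.inner_eq_star_dotProduct, dotProduct_comm]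

theorem quad_nonneg {M : Matrix (Fin d) (Fin d) ℝ} (hM : M.PosSemidef) (x : Vec d) :
    0 ≤ quad M x :=
  (Matrix.isPositive_toEuclideanLin_iff.2 hM).inner_nonneg_right x

theorem posSemidef_iff_quad_nonneg {M : Matrix (Fin d) (Fin d) ℝ} :
    M.PosSemidef ↔ M.IsHermitian ∧ ∀ x : Vec d, 0 ≤ quad M x := by
  refine ⟨fun hM => ⟨hM.isHermitian, quad_nonneg hM⟩, fun hM =>
    .of_dotProduct_mulVec_nonneg hM.1 fun x => ?_⟩
  simpa only [quad_eq_dotProduct] using hM.2 (WithLp.toLp 2 x)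

theorem posDef_of_quad_pos {M : Matrix (Fin d) (Fin d) ℝ} (hM : M.IsHermitian)
    (hpos : ∀ x : Vec d, x ≠ 0 → 0 < quad M x) : M.PosDef := by
  refine .of_dotProduct_mulVec_pos hM fun x hx => ?_
  simpa only [quad_eq_dotProduct] using hpos (WithLp.toLp 2 x) (by simpa using hx)

theorem le_iff_quad_le {M N : Matrix (Fin d) (Fin d) ℝ} (hM : M.IsHermitian)
    (hN : N.IsHermitian) : M ≤ N ↔ ∀ x : Vec d, quad M x ≤ quad N x := by
  simp only [Matrix.le_iff, posSemidef_iff_quad_nonneg, hN.sub hM, true_and, quad_sub, sub_nonneg]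

theorem quad_le (M : Matrix (Fin d) (Fin d) ℝ) (x : Vec d) : quad M x ≤ ‖M‖ * ‖x‖ ^ 2 :=
  calc quad M x ≤ ‖x‖ * ‖M.toEuclideanLin x‖ := real_inner_le_norm _ _
    _ ≤ ‖x‖ * (‖M‖ * ‖x‖) := by gcongr; exact norm_toEuclideanLin_le M x
    _ = ‖M‖ * ‖x‖ ^ 2 := by ring

theorem continuous_quad (M : Matrix (Fin d) (Fin d) ℝ) : Continuous (quad M) :=
  continuous_id.inner M.toEuclideanLin.continuous_of_finiteDimensional

theorem continuous_quad_left (x : Vec d) :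
    Continuous fun M : Matrix (Fin d) (Fin d) ℝ => quad M x := by
  simp only [quad_eq_dotProduct]
  fun_prop

theorem norm_sqrt_toEuclideanLin_sq {M : Matrix (Fin d) (Fin d) ℝ} (hM : M.PosSemidef)
    (x : Vec d) : ‖(CFC.sqrt M).toEuclideanLin x‖ ^ 2 = quad M x := by
  have hsymm : (CFC.sqrt M)ᵀ = CFC.sqrt M :=
    (Matrix.nonneg_iff_posSemidef.1 (CFC.sqrt_nonneg M)).isHermitian
  rw [← quad_transpose_mul_self, hsymm, CFC.sqrt_mul_sqrt_self M hM.nonneg]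

theorem exists_le_quad {M : Matrix (Fin d) (Fin d) ℝ} (hM : M.PosDef) :
    ∃ c : ℝ, 0 < c ∧ ∀ x : Vec d, c * ‖x‖ ^ 2 ≤ quad M x := by
  rcases isEmpty_or_nonempty (Fin d) with _ | _
  · exact ⟨1, one_pos, fun x => by simp [Subsingleton.elim x 0, quad]⟩
  obtain ⟨c, hc, hcM⟩ : ∃ c > 0, algebraMap ℝ (Matrix (Fin d) (Fin d) ℝ) c ≤ M :=
    (CFC.exists_pos_algebraMap_le_iff hM.isHermitian).2 fun _ => hM.isStrictlyPositive.spectrum_pos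
  refine ⟨c, hc, fun x => ?_⟩
  have hsub := quad_nonneg (Matrix.le_iff.1 hcM) x
  rw [quad_sub, Algebra.algebraMap_eq_smul_one, quad_smul, sub_nonneg] at hsub
  simpa [quad] using hsub

theorem quad_add_le {M : Matrix (Fin d) (Fin d) ℝ} (hM : M.PosSemidef) {η : ℝ} (hη : 0 < η)
    (x y : Vec d) : quad M (x + y) ≤ (1 + η) * quad M x + (1 + η⁻¹) * quad M y := by
  have hsq : 0 ≤ η⁻¹ * quad M (η • x - y) := by have := quad_nonneg hM (η • x - y); positivity
  rw [quad_sub_vec hM.isHermitian, quad_smul_vec, real_inner_smul_left] at hsq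
  rw [quad_add_vec hM.isHermitian]
  field_simp at hsq ⊢
  linarith

end Quad

/-! ### Lyapunov functions and detectability -/

section Lyapunov

open scoped Matrix.Norms.L2Operator Topology

variable {n l : ℕ}

theorem tendsto_pow_of_spectralRadius_lt_one {𝒜 : Type*} [NormedRing 𝒜] [NormedAlgebra ℂ 𝒜]
    [CompleteSpace 𝒜] {a : 𝒜} (ha : spectralRadius ℂ a < 1) :
    Filter.Tendsto (fun k : ℕ => a ^ k) Filter.atTop (𝓝 0) := by
  obtain ⟨r, har, hr⟩ := ENNReal.lt_iff_exists_nnreal_btwn.1 ha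
  have hroot : ∀ᶠ k : ℕ in Filter.atTop, (‖a ^ k‖₊ : ℝ≥0∞) ^ (1 / k : ℝ) < r :=
    (spectrum.pow_nnnorm_pow_one_div_tendsto_nhds_spectralRadius a).eventually_lt_const har
  refine squeeze_zero_norm' (a := fun k : ℕ => (r : ℝ) ^ k) ?_
    (tendsto_pow_atTop_nhds_zero_of_lt_one r.2 (by exact_mod_cast hr))
  filter_upwards [hroot, Filter.eventually_gt_atTop 0] with k hk hk0
  have hpow : (‖a ^ k‖₊ : ℝ≥0∞) ≤ (r : ℝ≥0∞) ^ k := by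
    rw [← ENNReal.rpow_natCast, ← ENNReal.rpow_inv_le_iff (by positivity), ← one_div]
    exact hk.le
  exact_mod_cast hpow

theorem IsSchurStable.tendsto_pow {A : Matrix (Fin n) (Fin n) ℝ} (hA : IsSchurStable A) :
    Filter.Tendsto (fun k : ℕ => A ^ k) Filter.atTop (𝓝 0) := by
  rcases isEmpty_or_nonempty (Fin n) with _ | _
  · exact tendsto_const_nhds.congr fun _ => Subsingleton.elim _ _
  have hradius : spectralRadius ℂ (A.map (algebraMap ℝ ℂ)) < ((1 : NNReal) : ℝ≥0∞) :=
    spectrum.spectralRadius_lt_of_forall_lt _ fun ev hev => by exact_mod_cast hA ev hev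
  have hre : Continuous fun M : Matrix (Fin n) (Fin n) ℂ => M.map Complex.re :=
    continuous_id.matrix_map Complex.continuous_re
  refine ((hre.tendsto' 0 0 (by ext; simp)).comp
    (tendsto_pow_of_spectralRadius_lt_one hradius)).congr fun k => ?_
  have hmap := map_pow (algebraMap ℝ ℂ).mapMatrix A k
  simp only [RingHom.mapMatrix_apply] at hmap
  rw [Function.comp_apply, ← hmap]
  ext i j
  simp

theorem IsSchurStable.exists_lyapunov {A : Matrix (Fin n) (Fin n) ℝ} (hA : IsSchurStable A) :
    ∃ T : Matrix (Fin n) (Fin n) ℝ, T.PosDef ∧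
      ∀ x : Vec n, quad T (A.toEuclideanLin x) + 1 / 2 * ‖x‖ ^ 2 ≤ quad T x := by
  obtain ⟨N, hN⟩ : ∃ N : ℕ, ‖A ^ N‖ ^ 2 ≤ 1 / 2 :=
    ((hA.tendsto_pow.norm.pow 2).eventually_le_const (by simp)).exists
  set T : Matrix (Fin n) (Fin n) ℝ := ∑ k ∈ Finset.range N, (A ^ k)ᵀ * A ^ k
  have hquad (x : Vec n) : quad T x = ∑ k ∈ Finset.range N, ‖(A ^ k).toEuclideanLin x‖ ^ 2 := by
    simp only [T, quad_sum, quad_transpose_mul_self]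
  have hdecay (x : Vec n) : quad T (A.toEuclideanLin x) + 1 / 2 * ‖x‖ ^ 2 ≤ quad T x := by
    have hshift : quad T (A.toEuclideanLin x) + ‖x‖ ^ 2 =
        quad T x + ‖(A ^ N).toEuclideanLin x‖ ^ 2 := by
      rw [hquad x, ← Finset.sum_range_succ, Finset.sum_range_succ', hquad]
      simp [pow_succ A, -Matrix.toLpLin_pow]
    have hlast : ‖(A ^ N).toEuclideanLin x‖ ^ 2 ≤ 1 / 2 * ‖x‖ ^ 2 := calc
      _ ≤ (‖A ^ N‖ * ‖x‖) ^ 2 := by gcongr; exact norm_toEuclideanLin_le _ x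
      _ ≤ 1 / 2 * ‖x‖ ^ 2 := by rw [mul_pow]; gcongr
    linarith
  have hT : T.PosSemidef := Matrix.posSemidef_sum _ fun k _ =>
    Matrix.posSemidef_conjTranspose_mul_self (A ^ k)
  refine ⟨T, posDef_of_quad_pos hT.isHermitian fun x hx => ?_, hdecay⟩
  have hnorm : 0 < ‖x‖ ^ 2 := by positivity
  linarith [hdecay x, quad_nonneg hT (A.toEuclideanLin x)]

theorem IsSchurStable.exists_perturbed_lyapunov {A : Matrix (Fin n) (Fin n) ℝ}
    (hA : IsSchurStable A) :
    ∃ T : Matrix (Fin n) (Fin n) ℝ, T.PosDef ∧ ∃ M : ℝ, 0 < M ∧ ∀ x w : Vec n,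
      quad T (A.toEuclideanLin x + w) + 1 / 4 * ‖x‖ ^ 2 ≤ quad T x + M * ‖w‖ ^ 2 := by
  obtain ⟨T, hT, hlyap⟩ := hA.exists_lyapunov
  obtain ⟨t, ht, hTt⟩ : ∃ t : ℝ, 0 < t ∧ ∀ x, quad T x ≤ t * ‖x‖ ^ 2 :=
    ⟨‖T‖ + 1, by positivity, fun x => (quad_le T x).trans (by gcongr; linarith)⟩
  refine ⟨T, hT, (1 + 4 * t) * t, by positivity, fun x w => ?_⟩
  have hyoung := quad_add_le hT.posSemidef (show 0 < (4 * t)⁻¹ by positivity)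
    (A.toEuclideanLin x) w
  have hstate : (4 * t)⁻¹ * quad T (A.toEuclideanLin x) ≤ 1 / 4 * ‖x‖ ^ 2 := by
    rw [inv_mul_le_iff₀ (by positivity)]
    linarith [hlyap x, hTt x, sq_nonneg ‖x‖]
  have hnoise : (1 + 4 * t) * quad T w ≤ (1 + 4 * t) * t * ‖w‖ ^ 2 := by
    rw [mul_assoc]
    gcongr
    exact hTt w
  rw [inv_inv] at hyoung
  linarith [hlyap x]

/-- `‖·‖²_T` is a storage function for the undisturbed system `x⁺ = A x + B u` with the supply
rate `‖x‖²_Q + ‖u‖²_R`, with dissipation at least `c (‖x‖² + ‖u‖²)`. -/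
def IsStorageMatrix (A : Matrix (Fin n) (Fin n) ℝ) (B : Matrix (Fin n) (Fin l) ℝ)
    (Q : Matrix (Fin n) (Fin n) ℝ) (R : Matrix (Fin l) (Fin l) ℝ) (T : Matrix (Fin n) (Fin n) ℝ)
    (c : ℝ) : Prop :=
  ∀ (x : Vec n) (u : Vec l), c * (‖x‖ ^ 2 + ‖u‖ ^ 2) ≤
    quad Q x + quad R u + quad T x - quad T (A.toEuclideanLin x + B.toEuclideanLin u)

variable {A : Matrix (Fin n) (Fin n) ℝ} {B : Matrix (Fin n) (Fin l) ℝ}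
  {Q : Matrix (Fin n) (Fin n) ℝ} {R : Matrix (Fin l) (Fin l) ℝ}

theorem norm_sub_mul_sqrt_sq_le {p : ℕ} (B : Matrix (Fin p) (Fin l) ℝ)
    (L : Matrix (Fin p) (Fin n) ℝ) (hQ : Q.PosSemidef) (x : Vec n) (u : Vec l) :
    ‖B.toEuclideanLin u - (L * CFC.sqrt Q).toEuclideanLin x‖ ^ 2 ≤
      2 * (‖B‖ ^ 2 * ‖u‖ ^ 2 + ‖L‖ ^ 2 * quad Q x) := by
  rw [toEuclideanLin_mul_apply, ← norm_sqrt_toEuclideanLin_sq hQ, ← mul_pow, ← mul_pow]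
  refine le_trans ?_ add_sq_le
  gcongr
  exact (norm_sub_le _ _).trans
    (add_le_add (norm_toEuclideanLin_le _ _) (norm_toEuclideanLin_le _ _))

/-- Output injection: `A x + B u = (A + L √Q) x + w` with `w = B u - L √Q x`, and the stage cost
dominates `‖w‖²`. -/
theorem IsDetectable.exists_le_add_stageCost (hdet : IsDetectable A (CFC.sqrt Q))
    (B : Matrix (Fin n) (Fin l) ℝ) (hQ : Q.PosSemidef) (hR : R.PosDef) :
    ∃ T : Matrix (Fin n) (Fin n) ℝ, T.PosDef ∧ ∃ a : ℝ, 0 < a ∧ ∀ (x : Vec n) (u : Vec l),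
      quad T (A.toEuclideanLin x + B.toEuclideanLin u) + 1 / 4 * ‖x‖ ^ 2 ≤
        quad T x + a * (quad Q x + quad R u) := by
  obtain ⟨L, hL⟩ := hdet
  obtain ⟨T, hT, M, hM, hlyap⟩ := hL.exists_perturbed_lyapunov
  obtain ⟨r, hr, hRle⟩ := exists_le_quad hR
  set g : ℝ := ‖B‖ ^ 2 * r⁻¹ + ‖L‖ ^ 2 + 1
  refine ⟨T, hT, M * (2 * g), by positivity, fun x u => ?_⟩
  set w : Vec n := B.toEuclideanLin u - (L * CFC.sqrt Q).toEuclideanLin x with hw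
  have hinj : A.toEuclideanLin x + B.toEuclideanLin u =
      (A + L * CFC.sqrt Q).toEuclideanLin x + w := by
    rw [hw, map_add, LinearMap.add_apply]
    abel
  have hu : ‖B‖ ^ 2 * ‖u‖ ^ 2 ≤ g * quad R u := calc
    ‖B‖ ^ 2 * ‖u‖ ^ 2 ≤ ‖B‖ ^ 2 * (r⁻¹ * quad R u) := by
      gcongr
      exact (le_inv_mul_iff₀ hr).2 (hRle u)
    _ ≤ g * quad R u := by
      rw [← mul_assoc]
      exact mul_le_mul_of_nonneg_right (by linarith [sq_nonneg ‖L‖])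
        (quad_nonneg hR.posSemidef u)
  have hx : ‖L‖ ^ 2 * quad Q x ≤ g * quad Q x :=
    mul_le_mul_of_nonneg_right (by linarith [show 0 ≤ ‖B‖ ^ 2 * r⁻¹ by positivity])
      (quad_nonneg hQ x)
  have hwle : M * ‖w‖ ^ 2 ≤ M * (2 * g * (quad Q x + quad R u)) := by
    gcongr
    linarith [norm_sub_mul_sqrt_sq_le B L hQ x u]
  rw [hinj, mul_assoc]
  linarith [hlyap x w]

theorem IsDetectable.exists_isStorageMatrix (hdet : IsDetectable A (CFC.sqrt Q))
    (B : Matrix (Fin n) (Fin l) ℝ) (hQ : Q.PosSemidef) (hR : R.PosDef) :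
    ∃ (T : Matrix (Fin n) (Fin n) ℝ) (c : ℝ), T.PosDef ∧ 0 < c ∧ IsStorageMatrix A B Q R T c := by
  obtain ⟨T, hT, a, ha, hdiss⟩ := hdet.exists_le_add_stageCost B hQ hR
  obtain ⟨r, hr, hRle⟩ := exists_le_quad hR
  refine ⟨(2 * a)⁻¹ • T, min (8 * a)⁻¹ (r / 2), hT.smul (by positivity), by positivity,
    fun x u => ?_⟩
  have hx : min (8 * a)⁻¹ (r / 2) * ‖x‖ ^ 2 ≤ (8 * a)⁻¹ * ‖x‖ ^ 2 := by
    gcongr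
    exact min_le_left _ _
  have hu : min (8 * a)⁻¹ (r / 2) * ‖u‖ ^ 2 ≤ 1 / 2 * quad R u := calc
    _ ≤ r / 2 * ‖u‖ ^ 2 := by gcongr; exact min_le_right _ _
    _ ≤ 1 / 2 * quad R u := by linarith [hRle u]
  have hscaled := mul_le_mul_of_nonneg_left (hdiss x u) (show 0 ≤ (2 * a)⁻¹ by positivity)
  have hcancel : (2 * a)⁻¹ * (a * (quad Q x + quad R u)) = 1 / 2 * (quad Q x + quad R u) := by
    field_simp
  have hcoeff : (2 * a)⁻¹ * (1 / 4 * ‖x‖ ^ 2) = (8 * a)⁻¹ * ‖x‖ ^ 2 := by ring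
  rw [mul_add, mul_add, hcancel, hcoeff] at hscaled
  rw [quad_smul, quad_smul]
  linarith [quad_nonneg hQ x]

end Lyapunov

/-! ### The discrete-time algebraic Riccati equation -/

section Riccati

open scoped Topology

variable {n l : ℕ}

theorem isClosed_setOf_posSemidef :
    IsClosed {M : Matrix (Fin n) (Fin n) ℝ | M.PosSemidef} := by
  simp only [posSemidef_iff_quad_nonneg, Set.ofPred_and, Set.ofPred_forall]
  exact (isClosed_eq continuous_id.matrix_conjTranspose continuous_id).inter
    (isClosed_iInter fun x => isClosed_le continuous_const (continuous_quad_left x))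

theorem matrix_apply_eq_quad {M : Matrix (Fin n) (Fin n) ℝ} (hM : M.IsHermitian) (i j : Fin n) :
    M i j = (quad M (EuclideanSpace.single i 1 + EuclideanSpace.single j 1)
      - quad M (EuclideanSpace.single i 1) - quad M (EuclideanSpace.single j 1)) / 2 := by
  have hentry : M i j =
      inner ℝ (EuclideanSpace.single i 1) (M.toEuclideanLin (EuclideanSpace.single j 1)) := by
    simp [EuclideanSpace.inner_single_left, Matrix.toLpLin_apply]
  rw [hentry, quad_add_vec hM]
  ring

theorem exists_tendsto_of_monotone {M : ℕ → Matrix (Fin n) (Fin n) ℝ}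
    (hsymm : ∀ k, (M k).IsHermitian) (hmono : Monotone M)
    {X : Matrix (Fin n) (Fin n) ℝ} (hX : X.IsHermitian) (hMX : ∀ k, M k ≤ X) :
    ∃ P, Filter.Tendsto M Filter.atTop (𝓝 P) := by
  have hquad (x : Vec n) : ∃ t, Filter.Tendsto (fun k => quad (M k) x) Filter.atTop (𝓝 t) :=
    ⟨_, tendsto_atTop_ciSup
      (fun j k hjk => (le_iff_quad_le (hsymm j) (hsymm k)).1 (hmono hjk) x)
      ⟨quad X x, Set.forall_mem_range.2 fun k => (le_iff_quad_le (hsymm k) hX).1 (hMX k) x⟩⟩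
  choose t ht using hquad
  refine ⟨Matrix.of fun i j => (t (EuclideanSpace.single i 1 + EuclideanSpace.single j 1)
    - t (EuclideanSpace.single i 1) - t (EuclideanSpace.single j 1)) / 2,
    tendsto_pi_nhds.2 fun i => tendsto_pi_nhds.2 fun j => ?_⟩
  simp only [fun k => matrix_apply_eq_quad (hsymm k) i j]
  exact (((ht _).sub (ht _)).sub (ht _)).div_const 2

/-- The iterates `f^[k] 0` increase and stay below the supersolution `X`. -/
theorem exists_posSemidef_fixedPoint
    {f : Matrix (Fin n) (Fin n) ℝ → Matrix (Fin n) (Fin n) ℝ}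
    (hf0 : ∀ P, P.PosSemidef → (f P).PosSemidef)
    (hmono : ∀ P P', P.PosSemidef → P ≤ P' → f P ≤ f P')
    (hcont : ∀ P, P.PosSemidef → ContinuousAt f P)
    {X : Matrix (Fin n) (Fin n) ℝ} (hX : X.PosSemidef) (hfX : f X ≤ X) :
    ∃ P, P.PosSemidef ∧ f P = P := by
  have hpos (k : ℕ) : (f^[k] 0).PosSemidef := by
    induction k with
    | zero => exact .zero
    | succ k ih => rw [Function.iterate_succ_apply']; exact hf0 _ ih
  have hle_succ (k : ℕ) : f^[k] 0 ≤ f^[k + 1] 0 := by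
    induction k with
    | zero => exact (hpos 1).nonneg
    | succ k ih =>
      rw [Function.iterate_succ_apply' f k, Function.iterate_succ_apply' f (k + 1)]
      exact hmono _ _ (hpos k) ih
  have hle (k : ℕ) : f^[k] 0 ≤ X := by
    induction k with
    | zero => exact hX.nonneg
    | succ k ih =>
      rw [Function.iterate_succ_apply']
      exact (hmono _ _ (hpos k) ih).trans hfX
  obtain ⟨P, hP⟩ := exists_tendsto_of_monotone (fun k => (hpos k).isHermitian)
    (monotone_nat_of_le_succ hle_succ) hX.isHermitian hle
  have hP0 : P.PosSemidef := isClosed_setOf_posSemidef.mem_of_tendsto hP (.of_forall hpos)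
  exact ⟨P, hP0, isFixedPt_of_tendsto_iterate hP (hcont P hP0)⟩

/-- The gain of the feedback that minimizes the one-step cost `‖u‖²_R + ‖A x + B u‖²_P`. -/
noncomputable def riccatiGain (A : Matrix (Fin n) (Fin n) ℝ) (B : Matrix (Fin n) (Fin l) ℝ)
    (R : Matrix (Fin l) (Fin l) ℝ) (P : Matrix (Fin n) (Fin n) ℝ) : Matrix (Fin l) (Fin n) ℝ :=
  -((R + Bᵀ * P * B)⁻¹ * Bᵀ * P * A)

/-- The right-hand side of the discrete-time algebraic Riccati equation, as a function of `P`. -/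
noncomputable def riccatiMap (A : Matrix (Fin n) (Fin n) ℝ) (B : Matrix (Fin n) (Fin l) ℝ)
    (Q : Matrix (Fin n) (Fin n) ℝ) (R : Matrix (Fin l) (Fin l) ℝ) (P : Matrix (Fin n) (Fin n) ℝ) :
    Matrix (Fin n) (Fin n) ℝ :=
  Aᵀ * P * A + Q - Aᵀ * P * B * (R + Bᵀ * P * B)⁻¹ * Bᵀ * P * A

variable {A : Matrix (Fin n) (Fin n) ℝ} {B : Matrix (Fin n) (Fin l) ℝ}
  {Q : Matrix (Fin n) (Fin n) ℝ} {R : Matrix (Fin l) (Fin l) ℝ} {P : Matrix (Fin n) (Fin n) ℝ}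

theorem isUnit_det_add_transpose_mul_mul (hR : R.PosDef) (hP : P.PosSemidef)
    (B : Matrix (Fin n) (Fin l) ℝ) : IsUnit (R + Bᵀ * P * B).det :=
  (Matrix.isUnit_iff_isUnit_det _).1
    (hR.add_posSemidef (hP.conjTranspose_mul_mul_same B)).isUnit

theorem mul_riccatiGain_add (hR : R.PosDef) (hP : P.PosSemidef) :
    R * riccatiGain A B R P + Bᵀ * P * (A + B * riccatiGain A B R P) = 0 := by
  have hsolve : (R + Bᵀ * P * B) * riccatiGain A B R P = -(Bᵀ * P * A) := by
    rw [riccatiGain, Matrix.mul_neg, Matrix.mul_assoc _ Bᵀ, Matrix.mul_assoc _ (Bᵀ * P),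
      Matrix.mul_nonsing_inv_cancel_left _ _ (isUnit_det_add_transpose_mul_mul hR hP B)]
  calc R * riccatiGain A B R P + Bᵀ * P * (A + B * riccatiGain A B R P)
      = (R + Bᵀ * P * B) * riccatiGain A B R P + Bᵀ * P * A := by
        simp only [Matrix.mul_add, Matrix.add_mul, Matrix.mul_assoc]
        abel
    _ = 0 := by rw [hsolve, neg_add_cancel]

theorem riccatiMap_eq_mul_closedLoop :
    riccatiMap A B Q R P = Aᵀ * P * (A + B * riccatiGain A B R P) + Q := by
  simp only [riccatiMap, riccatiGain, Matrix.mul_add, Matrix.mul_neg, Matrix.mul_assoc]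
  abel

theorem riccatiMap_eq_closedLoop (hR : R.PosDef) (hP : P.PosSemidef) :
    riccatiMap A B Q R P = (A + B * riccatiGain A B R P)ᵀ * P * (A + B * riccatiGain A B R P)
      + (riccatiGain A B R P)ᵀ * R * riccatiGain A B R P + Q := by
  have hgain := congrArg ((riccatiGain A B R P)ᵀ * ·) (mul_riccatiGain_add (A := A) hR hP (B := B))
  rw [riccatiMap_eq_mul_closedLoop, ← sub_eq_zero, ← neg_eq_zero,
    ← hgain.trans (Matrix.mul_zero _)]
  simp only [Matrix.transpose_add, Matrix.transpose_mul, Matrix.mul_add, Matrix.add_mul,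
    Matrix.mul_assoc]
  abel

theorem posSemidef_riccatiMap (hQ : Q.PosSemidef) (hR : R.PosDef) (hP : P.PosSemidef) :
    (riccatiMap A B Q R P).PosSemidef := by
  rw [riccatiMap_eq_closedLoop hR hP]
  exact ((hP.conjTranspose_mul_mul_same _).add (hR.posSemidef.conjTranspose_mul_mul_same _)).add hQ

theorem quad_riccatiMap (hR : R.PosDef) (hP : P.PosSemidef) (x : Vec n) :
    quad (riccatiMap A B Q R P) x = quad Q x + quad R ((riccatiGain A B R P).toEuclideanLin x)
      + quad P ((A + B * riccatiGain A B R P).toEuclideanLin x) := by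
  rw [riccatiMap_eq_closedLoop hR hP, quad_add, quad_add, quad_transpose_mul_mul,
    quad_transpose_mul_mul]
  ring

theorem inner_riccatiGain_add (hR : R.PosDef) (hP : P.PosSemidef) (x : Vec n) (u : Vec l) :
    inner ℝ u (R.toEuclideanLin ((riccatiGain A B R P).toEuclideanLin x)) +
      inner ℝ (B.toEuclideanLin u)
        (P.toEuclideanLin ((A + B * riccatiGain A B R P).toEuclideanLin x)) = 0 := by
  rw [← inner_transpose, ← inner_add_right]
  simp only [← toEuclideanLin_mul_apply]
  rw [← LinearMap.add_apply, ← map_add, ← Matrix.mul_assoc, mul_riccatiGain_add hR hP]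
  simp

theorem quad_riccatiMap_le (hR : R.PosDef) (hP : P.PosSemidef) (x : Vec n) (u : Vec l) :
    quad (riccatiMap A B Q R P) x
      ≤ quad Q x + quad R u + quad P (A.toEuclideanLin x + B.toEuclideanLin u) := by
  obtain ⟨w, rfl⟩ : ∃ w, u = w + (riccatiGain A B R P).toEuclideanLin x :=
    ⟨_, (sub_add_cancel u _).symm⟩
  have hsplit : A.toEuclideanLin x +
      B.toEuclideanLin (w + (riccatiGain A B R P).toEuclideanLin x) =
      B.toEuclideanLin w + (A + B * riccatiGain A B R P).toEuclideanLin x := by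
    rw [toEuclideanLin_add_mul_apply, map_add]
    abel
  rw [quad_riccatiMap hR hP, hsplit, quad_add_vec hR.isHermitian, quad_add_vec hP.isHermitian]
  linarith [inner_riccatiGain_add (A := A) (B := B) hR hP x w, quad_nonneg hR.posSemidef w,
    quad_nonneg hP (B.toEuclideanLin w)]

theorem riccatiMap_mono (hQ : Q.PosSemidef) (hR : R.PosDef) (hP : P.PosSemidef)
    {P' : Matrix (Fin n) (Fin n) ℝ} (hPP' : P ≤ P') :
    riccatiMap A B Q R P ≤ riccatiMap A B Q R P' := by
  have hP' : P'.PosSemidef := Matrix.nonneg_iff_posSemidef.1 (hP.nonneg.trans hPP')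
  rw [le_iff_quad_le (posSemidef_riccatiMap hQ hR hP).isHermitian
    (posSemidef_riccatiMap hQ hR hP').isHermitian]
  intro x
  rw [quad_riccatiMap hR hP']
  refine (quad_riccatiMap_le hR hP x ((riccatiGain A B R P').toEuclideanLin x)).trans ?_
  rw [← toEuclideanLin_add_mul_apply]
  gcongr
  exact (le_iff_quad_le hP.isHermitian hP'.isHermitian).1 hPP' _

theorem continuousAt_riccatiMap (hR : R.PosDef) (hP : P.PosSemidef) :
    ContinuousAt (riccatiMap A B Q R) P := by
  have hinv : ContinuousAt (fun P : Matrix (Fin n) (Fin n) ℝ => (R + Bᵀ * P * B)⁻¹) P := by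
    have hcont : Continuous fun P : Matrix (Fin n) (Fin n) ℝ => R + Bᵀ * P * B := by fun_prop
    simp only [Matrix.inv_def, Ring.inverse_eq_inv']
    exact (hcont.matrix_det.continuousAt.inv₀
      (isUnit_det_add_transpose_mul_mul hR hP B).ne_zero).smul
        hcont.matrix_adjugate.continuousAt
  unfold riccatiMap
  fun_prop

/-- A scaled Lyapunov function of `A + B F` is a supersolution. -/
theorem IsStabilizable.exists_riccatiMap_le (hstab : IsStabilizable A B) (hQ : Q.PosSemidef)
    (hR : R.PosDef) : ∃ X, X.PosSemidef ∧ riccatiMap A B Q R X ≤ X := by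
  obtain ⟨F, hF⟩ := hstab
  obtain ⟨T, hT, hlyap⟩ := hF.exists_lyapunov
  open scoped Matrix.Norms.L2Operator in
  set t : ℝ := ‖Q + Fᵀ * R * F‖ with ht
  have hX : ((2 * t) • T).PosSemidef := hT.posSemidef.smul (by positivity)
  refine ⟨(2 * t) • T, hX, (le_iff_quad_le (posSemidef_riccatiMap hQ hR hX).isHermitian
    hX.isHermitian).2 fun x => (quad_riccatiMap_le hR hX x (F.toEuclideanLin x)).trans ?_⟩
  have hcost := quad_le (Q + Fᵀ * R * F) x
  rw [quad_add, quad_transpose_mul_mul, ← ht] at hcost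
  have hscaled := mul_le_mul_of_nonneg_left (hlyap x) (show 0 ≤ 2 * t by positivity)
  rw [← toEuclideanLin_add_mul_apply, quad_smul, quad_smul]
  linarith

theorem IsStabilizable.exists_riccati (hstab : IsStabilizable A B) (hQ : Q.PosSemidef)
    (hR : R.PosDef) : ∃ P, P.PosSemidef ∧ riccatiMap A B Q R P = P := by
  obtain ⟨X, hX, hle⟩ := hstab.exists_riccatiMap_le hQ hR
  exact exists_posSemidef_fixedPoint (fun _ => posSemidef_riccatiMap hQ hR)
    (fun _ _ hP hPP' => riccatiMap_mono hQ hR hP hPP') (fun _ => continuousAt_riccatiMap hR) hX hle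

end Riccati

/-! ### Optimal steady states -/

section SteadyState

theorem exists_lagrange_multiplier {K E F : Type*} [Field K] [AddCommGroup E] [Module K E]
    [FiniteDimensional K E] [AddCommGroup F] [Module K F] (β : E →ₗ[K] Module.Dual K E)
    (G : E →ₗ[K] F) (hβ : ∀ x, G x = 0 → β x x = 0 → x = 0) (b : Module.Dual K E) :
    ∃ w, G w = 0 ∧ ∃ φ : Module.Dual K F, ∀ z, β w z + b z + φ (G z) = 0 := by
  set β' : LinearMap.ker G →ₗ[K] Module.Dual K (LinearMap.ker G) :=
    (LinearMap.ker G).subtype.dualMap ∘ₗ β ∘ₗ (LinearMap.ker G).subtype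
  have hinj : Function.Injective β' := by
    rw [injective_iff_map_eq_zero]
    intro x hx
    exact Subtype.ext (hβ x x.2 (LinearMap.congr_fun hx x))
  have hsurj : Function.Surjective β' :=
    (LinearMap.injective_iff_surjective_of_finrank_eq_finrank Subspace.dual_finrank_eq.symm).1 hinj
  obtain ⟨w, hw⟩ := hsurj (-(LinearMap.ker G).subtype.dualMap b)
  have hann : -(β w + b) ∈ LinearMap.range G.dualMap := by
    rw [LinearMap.range_dualMap_eq_dualAnnihilator_ker, Submodule.mem_dualAnnihilator]
    intro z hz
    have hwz : β w z = -b z := LinearMap.congr_fun hw ⟨z, hz⟩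
    simp [hwz]
  obtain ⟨φ, hφ⟩ := hann
  refine ⟨w, w.2, φ, fun z => ?_⟩
  have hφz : φ (G z) = -(β w z + b z) := LinearMap.congr_fun hφ z
  rw [hφz, add_neg_cancel]

variable {n l : ℕ} {A : Matrix (Fin n) (Fin n) ℝ} {B : Matrix (Fin n) (Fin l) ℝ}
  {Q T : Matrix (Fin n) (Fin n) ℝ} {R : Matrix (Fin l) (Fin l) ℝ} {c : ℝ}
  {a q xt : Vec n} {b ut : Vec l}

theorem steadyState_iff {x w : Vec n} {u : Vec l} :
    (1 - A).toEuclideanLin x - B.toEuclideanLin u = w ↔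
      A.toEuclideanLin x + B.toEuclideanLin u + w = x := by
  have hexpand : (1 - A).toEuclideanLin x = x - A.toEuclideanLin x := by
    simp [Matrix.toLpLin_one]
  rw [hexpand, sub_sub, sub_eq_iff_eq_add, eq_comm, add_comm w]

/-- The Karush–Kuhn–Tucker conditions, with multiplier `q`, for minimising
`xᵀ Q x + uᵀ R u + aᵀ x + bᵀ u` over the steady states `A x + B u = x`. -/
structure IsOptimalSteadyState (A : Matrix (Fin n) (Fin n) ℝ) (B : Matrix (Fin n) (Fin l) ℝ)
    (Q : Matrix (Fin n) (Fin n) ℝ) (R : Matrix (Fin l) (Fin l) ℝ) (a : Vec n) (b : Vec l)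
    (xt : Vec n) (ut : Vec l) (q : Vec n) : Prop where
  steady : A.toEuclideanLin xt + B.toEuclideanLin ut = xt
  stationary : ∀ x u, 2 * (inner ℝ x (Q.toEuclideanLin xt) + inner ℝ u (R.toEuclideanLin ut))
    + inner ℝ a x + inner ℝ b u + inner ℝ q (x - (A.toEuclideanLin x + B.toEuclideanLin u)) = 0

theorem IsStorageMatrix.exists_isOptimalSteadyState (hT : IsStorageMatrix A B Q R T c)
    (hc : 0 < c) (a : Vec n) (b : Vec l) :
    ∃ xt ut q, IsOptimalSteadyState A B Q R a b xt ut q := by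
  let fst : Vec n × Vec l →ₗ[ℝ] Vec n := LinearMap.fst ℝ _ _
  let snd : Vec n × Vec l →ₗ[ℝ] Vec l := LinearMap.snd ℝ _ _
  let residual := fst - (A.toEuclideanLin ∘ₗ fst + B.toEuclideanLin ∘ₗ snd)
  let hessian : Vec n × Vec l →ₗ[ℝ] Module.Dual ℝ (Vec n × Vec l) :=
    (2 : ℝ) • ((innerₗ (Vec n)).compl₁₂ (Q.toEuclideanLin ∘ₗ fst) fst
      + (innerₗ (Vec l)).compl₁₂ (R.toEuclideanLin ∘ₗ snd) snd)
  have hdef : ∀ p, residual p = 0 → hessian p p = 0 → p = 0 := by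
    rintro ⟨x, u⟩ hres hzero
    have hsteady : A.toEuclideanLin x + B.toEuclideanLin u = x := (sub_eq_zero.1 hres).symm
    have hquad : 2 * (quad Q x + quad R u) = 0 := by
      rw [quad, quad, real_inner_comm, real_inner_comm _ u]
      exact hzero
    have hcoer := hT x u
    rw [hsteady] at hcoer
    have hnorm : ‖x‖ ^ 2 + ‖u‖ ^ 2 ≤ 0 := by
      refine nonpos_of_mul_nonpos_right (le_of_le_of_eq hcoer ?_) hc
      linarith
    have hx : ‖x‖ ^ 2 = 0 := by linarith [sq_nonneg ‖x‖, sq_nonneg ‖u‖]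
    have hu : ‖u‖ ^ 2 = 0 := by linarith [sq_nonneg ‖x‖, sq_nonneg ‖u‖]
    simpa using And.intro hx hu
  obtain ⟨⟨xt, ut⟩, hsteady, φ, hφ⟩ := exists_lagrange_multiplier hessian residual hdef
    (innerₗ _ a ∘ₗ fst + innerₗ _ b ∘ₗ snd)
  refine ⟨xt, ut, (InnerProductSpace.toDual ℝ _).symm (LinearMap.toContinuousLinearMap φ),
    (sub_eq_zero.1 hsteady).symm, fun x u => ?_⟩
  rw [InnerProductSpace.toDual_symm_apply, real_inner_comm, real_inner_comm _ u, add_assoc (2 * _)]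
  exact hφ (x, u)

theorem IsOptimalSteadyState.growth (h : IsOptimalSteadyState A B Q R a b xt ut q)
    (hQ : Q.IsHermitian) (hR : R.IsHermitian) (hT : T.IsHermitian)
    (hstorage : IsStorageMatrix A B Q R T c) (x : Vec n) (u : Vec l) :
    c * (‖x - xt‖ ^ 2 + ‖u - ut‖ ^ 2) ≤ quad Q x - quad Q xt + (quad R u - quad R ut)
      + inner ℝ a (x - xt) + inner ℝ b (u - ut)
      + (quad T x + inner ℝ (q - (2 : ℝ) • T.toEuclideanLin xt) x)
      - (quad T (A.toEuclideanLin x + B.toEuclideanLin u)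
        + inner ℝ (q - (2 : ℝ) • T.toEuclideanLin xt)
          (A.toEuclideanLin x + B.toEuclideanLin u)) := by
  obtain ⟨y, rfl⟩ : ∃ y, x = y + xt := ⟨x - xt, by abel⟩
  obtain ⟨w, rfl⟩ : ∃ w, u = w + ut := ⟨u - ut, by abel⟩
  have hnext : A.toEuclideanLin (y + xt) + B.toEuclideanLin (w + ut)
      = A.toEuclideanLin y + B.toEuclideanLin w + xt := by
    conv_rhs => rw [← h.steady]
    simp only [map_add]
    abel
  have hcoer := hstorage y w
  have hkkt := h.stationary y w
  rw [inner_sub_right] at hkkt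
  rw [hnext, add_sub_cancel_right, add_sub_cancel_right]
  generalize A.toEuclideanLin y + B.toEuclideanLin w = y' at *
  rw [quad_add_vec hQ, quad_add_vec hR, quad_add_vec hT y, quad_add_vec hT y']
  simp only [inner_sub_left, inner_add_right, inner_smul_left, RCLike.conj_to_real,
    real_inner_comm y (T.toEuclideanLin xt), real_inner_comm y' (T.toEuclideanLin xt)]
  linarith

end SteadyState

section ClosedLoop

open scoped Matrix.Norms.L2Operator

variable {n l : ℕ} {A : Matrix (Fin n) (Fin n) ℝ} {B : Matrix (Fin n) (Fin l) ℝ}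
  {Q Q' T P : Matrix (Fin n) (Fin n) ℝ} {R R' : Matrix (Fin l) (Fin l) ℝ} {c : ℝ}

theorem IsStorageMatrix.closedLoop_lyapunov (hT : IsStorageMatrix A B Q R T c) (hc : 0 ≤ c)
    (hQ' : Q'.PosSemidef) (hR' : R'.PosSemidef) (hRR' : (R + R').PosDef) (hP : P.PosSemidef)
    (hric : riccatiMap A B (Q + Q') (R + R') P = P) (x : Vec n) :
    quad (P + T) ((A + B * riccatiGain A B (R + R') P).toEuclideanLin x) + c * ‖x‖ ^ 2
      ≤ quad (P + T) x := by
  have hvalue := quad_riccatiMap (A := A) (B := B) (Q := Q + Q') hRR' hP x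
  rw [hric] at hvalue
  set u := (riccatiGain A B (R + R') P).toEuclideanLin x with hu
  have hcoer := hT x u
  rw [hu, ← toEuclideanLin_add_mul_apply, ← hu] at hcoer
  simp only [quad_add] at hvalue ⊢
  nlinarith [quad_nonneg hQ' x, quad_nonneg hR' u, mul_nonneg hc (sq_nonneg ‖u‖)]

theorem quad_pow_le {G L : Matrix (Fin n) (Fin n) ℝ} {θ : ℝ} (hθ : 0 ≤ θ)
    (h : ∀ x : Vec n, quad L (G.toEuclideanLin x) ≤ θ * quad L x) (j : ℕ) (x : Vec n) :
    quad L ((G ^ j).toEuclideanLin x) ≤ θ ^ j * quad L x := by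
  induction j generalizing x with
  | zero => simp
  | succ j ih =>
    rw [pow_succ' G, toEuclideanLin_mul_apply, pow_succ', mul_assoc]
    exact (h _).trans (mul_le_mul_of_nonneg_left (ih x) hθ)

theorem exists_contraction_of_lyapunov {G L : Matrix (Fin n) (Fin n) ℝ} (hc : 0 < c)
    (h : ∀ x : Vec n, quad L (G.toEuclideanLin x) + c * ‖x‖ ^ 2 ≤ quad L x) :
    ∃ θ : ℝ, 0 ≤ θ ∧ θ < 1 ∧ ∀ x : Vec n, quad L (G.toEuclideanLin x) ≤ θ * quad L x := by
  have hC : 0 < ‖L‖ + c := by positivity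
  refine ⟨1 - c / (‖L‖ + c), ?_, sub_lt_self _ (by positivity), fun x => ?_⟩
  · rw [sub_nonneg, div_le_one hC]
    exact le_add_of_nonneg_left (norm_nonneg L)
  · have hle : quad L x ≤ (‖L‖ + c) * ‖x‖ ^ 2 :=
      (quad_le L x).trans (by gcongr; exact le_add_of_nonneg_right hc.le)
    have hfrac : c / (‖L‖ + c) * quad L x ≤ c * ‖x‖ ^ 2 := by
      rw [div_mul_eq_mul_div, div_le_iff₀ hC]
      nlinarith
    linarith [h x]

theorem exists_norm_pow_le_of_lyapunov {G L : Matrix (Fin n) (Fin n) ℝ} (hL : L.PosDef)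
    (hc : 0 < c) (h : ∀ x : Vec n, quad L (G.toEuclideanLin x) + c * ‖x‖ ^ 2 ≤ quad L x) :
    ∃ a r : ℝ, 0 ≤ a ∧ 0 ≤ r ∧ r < 1 ∧
      ∀ (j : ℕ) (x : Vec n), ‖(G ^ j).toEuclideanLin x‖ ≤ a * r ^ j * ‖x‖ := by
  obtain ⟨θ, hθ₀, hθ₁, hstep⟩ := exists_contraction_of_lyapunov hc h
  obtain ⟨b, hb, hge⟩ := exists_le_quad hL
  refine ⟨√(‖L‖ / b), √θ, Real.sqrt_nonneg _, Real.sqrt_nonneg _, ?_, fun j x => ?_⟩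
  · rwa [Real.sqrt_lt' one_pos, one_pow]
  · refine (sq_le_sq₀ (norm_nonneg _) (by positivity)).1 ?_
    rw [mul_pow, mul_pow, ← pow_mul, mul_comm j 2, pow_mul, Real.sq_sqrt hθ₀,
      Real.sq_sqrt (by positivity), div_mul_eq_mul_div, div_mul_eq_mul_div, le_div_iff₀ hb]
    calc ‖(G ^ j).toEuclideanLin x‖ ^ 2 * b
        ≤ quad L ((G ^ j).toEuclideanLin x) := by
          rw [mul_comm]
          exact hge _
      _ ≤ θ ^ j * quad L x := quad_pow_le hθ₀ hstep j x
      _ ≤ θ ^ j * (‖L‖ * ‖x‖ ^ 2) := by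
          gcongr
          exact quad_le L x
      _ = ‖L‖ * θ ^ j * ‖x‖ ^ 2 := by ring

theorem eq_zero_of_fixed_of_lyapunov {G L : Matrix (Fin n) (Fin n) ℝ} (hc : 0 < c)
    (h : ∀ x : Vec n, quad L (G.toEuclideanLin x) + c * ‖x‖ ^ 2 ≤ quad L x) {x : Vec n}
    (hx : G.toEuclideanLin x = x) : x = 0 := by
  have hle := h x
  rw [hx, add_le_iff_nonpos_right] at hle
  have hsq : ‖x‖ ^ 2 = 0 := le_antisymm (nonpos_of_mul_nonpos_right hle hc) (sq_nonneg _)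
  simpa using hsq

end ClosedLoop

section Design

variable {n l m : ℕ} {S : Problem n l m} {meanW : Vec m} {xs xt q : Vec n} {us ut : Vec l}
  {P T : Matrix (Fin n) (Fin n) ℝ} {c : ℝ}

/-- The matrices and vectors from which the storage function and the optimal feedback are built.
In `growth`, the linear terms come from expanding the cost around the steady state `(xs, us)`. -/
structure Problem.IsDesign (S : Problem n l m) (meanW : Vec m) (xs : Vec n) (us : Vec l)
    (P T : Matrix (Fin n) (Fin n) ℝ) (q xt : Vec n) (ut : Vec l) (c : ℝ) : Prop where
  posSemidef_Q₁ : S.Q₁.PosSemidef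
  posSemidef_Q₂ : S.Q₂.PosSemidef
  posDef_R₁ : S.R₁.PosDef
  posSemidef_R₂ : S.R₂.PosSemidef
  steady : S.A.toEuclideanLin xs + S.B.toEuclideanLin us + (S.E.toEuclideanLin meanW + S.z) = xs
  posSemidef_P : P.PosSemidef
  riccati : riccatiMap S.A S.B (S.Q₁ + S.Q₂) (S.R₁ + S.R₂) P = P
  posDef_T : T.PosDef
  pos : 0 < c
  isStorageMatrix : IsStorageMatrix S.A S.B S.Q₁ S.R₁ T c
  steady_shift : S.A.toEuclideanLin xt + S.B.toEuclideanLin ut = xt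
  growth : ∀ (x : Vec n) (u : Vec l), c * (‖x - xt‖ ^ 2 + ‖u - ut‖ ^ 2) ≤
    quad S.Q₁ x - quad S.Q₁ xt + (quad S.R₁ u - quad S.R₁ ut)
      + inner ℝ ((2 : ℝ) • S.Q₁.toEuclideanLin xs + S.s) (x - xt)
      + inner ℝ ((2 : ℝ) • S.R₁.toEuclideanLin us + S.v) (u - ut)
      + (quad T x + inner ℝ q x)
      - (quad T (S.A.toEuclideanLin x + S.B.toEuclideanLin u)
        + inner ℝ q (S.A.toEuclideanLin x + S.B.toEuclideanLin u))

theorem Problem.exists_isDesign (hstab : IsStabilizable S.A S.B) (hQ₁ : S.Q₁.PosSemidef)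
    (hQ₂ : S.Q₂.PosSemidef) (hR₁ : S.R₁.PosDef) (hR₂ : S.R₂.PosSemidef)
    (hsteady : (1 - S.A).toEuclideanLin xs - S.B.toEuclideanLin us =
      S.E.toEuclideanLin meanW + S.z) (hdet : IsDetectable S.A (CFC.sqrt S.Q₁)) :
    ∃ P T q xt ut c, S.IsDesign meanW xs us P T q xt ut c := by
  obtain ⟨T, c, hT, hc, hstorage⟩ := hdet.exists_isStorageMatrix S.B hQ₁ hR₁
  obtain ⟨P, hP, hric⟩ := hstab.exists_riccati (hQ₁.add hQ₂) (hR₁.add_posSemidef hR₂)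
  obtain ⟨xt, ut, q, hopt⟩ := hstorage.exists_isOptimalSteadyState hc
    ((2 : ℝ) • S.Q₁.toEuclideanLin xs + S.s) ((2 : ℝ) • S.R₁.toEuclideanLin us + S.v)
  exact ⟨P, T, _, xt, ut, c, hQ₁, hQ₂, hR₁, hR₂, steadyState_iff.1 hsteady, hP, hric, hT, hc,
    hstorage, hopt.steady,
    hopt.growth hQ₁.isHermitian hR₁.isHermitian hT.isHermitian hstorage⟩

theorem Problem.gain_eq (S : Problem n l m) :
    S.gain P = riccatiGain S.A S.B (S.R₁ + S.R₂) P :=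
  rfl

namespace Problem.IsDesign

variable (h : S.IsDesign meanW xs us P T q xt ut c)
include h

theorem posDef_R : (S.R₁ + S.R₂).PosDef :=
  h.posDef_R₁.add_posSemidef h.posSemidef_R₂

theorem isRiccatiSolution : S.IsRiccatiSolution P :=
  ⟨h.posSemidef_P, h.riccati.symm⟩

theorem closedLoop_lyapunov (x : Vec n) :
    quad (P + T) ((S.A + S.B * S.gain P).toEuclideanLin x) + c * ‖x‖ ^ 2 ≤ quad (P + T) x :=
  h.isStorageMatrix.closedLoop_lyapunov h.pos.le h.posSemidef_Q₂ h.posSemidef_R₂ h.posDef_R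
    h.posSemidef_P h.riccati x

end Problem.IsDesign

end Design

/-! ### Expectations and covariances -/

section Expectation

variable {Ω : Type*} [MeasurableSpace Ω] {μ : Measure Ω} {f g : Ω → ℝ} {a b : ℝ}

/-- The random variable `f` is integrable with expectation `a`. Keeping integrability and value
together lets linear combinations of expectations be computed without side conditions. -/
structure HasExp (μ : Measure Ω) (f : Ω → ℝ) (a : ℝ) : Prop where
  integrable : Integrable f μ
  integral_eq : ∫ ω, f ω ∂μ = a

theorem hasExp_integral (hf : Integrable f μ) : HasExp μ f (∫ ω, f ω ∂μ) :=
  ⟨hf, rfl⟩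

theorem HasExp.add (hf : HasExp μ f a) (hg : HasExp μ g b) :
    HasExp μ (fun ω => f ω + g ω) (a + b) :=
  ⟨hf.integrable.add hg.integrable,
    by rw [integral_add hf.integrable hg.integrable, hf.integral_eq, hg.integral_eq]⟩

theorem HasExp.sub (hf : HasExp μ f a) (hg : HasExp μ g b) :
    HasExp μ (fun ω => f ω - g ω) (a - b) :=
  ⟨hf.integrable.sub hg.integrable,
    by rw [integral_sub hf.integrable hg.integrable, hf.integral_eq, hg.integral_eq]⟩

theorem HasExp.const_mul (hf : HasExp μ f a) (r : ℝ) : HasExp μ (fun ω => r * f ω) (r * a) :=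
  ⟨hf.integrable.const_mul r, by rw [integral_const_mul, hf.integral_eq]⟩

theorem HasExp.mono (hf : HasExp μ f a) (hg : HasExp μ g b) (h : ∀ ω, f ω ≤ g ω) : a ≤ b := by
  rw [← hf.integral_eq, ← hg.integral_eq]
  exact integral_mono hf.integrable hg.integrable h

end Expectation

section L2

variable {d e : ℕ} {Ω : Type*} [MeasurableSpace Ω] {μ : Measure Ω} {X Y : Ω → Vec d}

theorem continuous_toEuclideanLin (M : Matrix (Fin e) (Fin d) ℝ) :
    Continuous fun x : Vec d => M.toEuclideanLin x :=
  M.toEuclideanLin.continuous_of_finiteDimensional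

theorem IsL2.add (hX : IsL2 μ X) (hY : IsL2 μ Y) : IsL2 μ fun ω => X ω + Y ω :=
  ⟨hX.1.add hY.1, hX.2.add hY.2⟩

theorem IsL2.sub (hX : IsL2 μ X) (hY : IsL2 μ Y) : IsL2 μ fun ω => X ω - Y ω :=
  ⟨hX.1.sub hY.1, hX.2.sub hY.2⟩

theorem IsL2.const [IsFiniteMeasure μ] (x : Vec d) : IsL2 μ fun _ => x :=
  ⟨measurable_const, memLp_const x⟩

theorem IsL2.toEuclideanLin (hX : IsL2 μ X) (M : Matrix (Fin e) (Fin d) ℝ) :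
    IsL2 μ fun ω => M.toEuclideanLin (X ω) :=
  ⟨(continuous_toEuclideanLin M).measurable.comp hX.1,
    M.toEuclideanLin.toContinuousLinearMap.comp_memLp' hX.2⟩

theorem IsL2.integrable [IsFiniteMeasure μ] (hX : IsL2 μ X) : Integrable X μ :=
  hX.2.integrable (by norm_num)

theorem IsL2.integrable_norm_sq (hX : IsL2 μ X) : Integrable (fun ω => ‖X ω‖ ^ 2) μ :=
  (memLp_two_iff_integrable_sq_norm hX.2.aestronglyMeasurable).1 hX.2

theorem IsL2.integrable_inner (hX : IsL2 μ X) (hY : IsL2 μ Y) :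
    Integrable (fun ω => inner ℝ (X ω) (Y ω)) μ :=
  (hX.2.norm.integrable_mul hY.2.norm).mono'
    (hX.2.aestronglyMeasurable.inner hY.2.aestronglyMeasurable)
    (Filter.Eventually.of_forall fun _ => norm_inner_le_norm _ _)

theorem IsL2.integrable_quad (hX : IsL2 μ X) (M : Matrix (Fin d) (Fin d) ℝ) :
    Integrable (fun ω => quad M (X ω)) μ :=
  hX.integrable_inner (hX.toEuclideanLin M)

theorem IsL2.hasExp_const_inner [IsFiniteMeasure μ] (hX : IsL2 μ X) (x : Vec d) :
    HasExp μ (fun ω => inner ℝ x (X ω)) (inner ℝ x (∫ ω, X ω ∂μ)) :=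
  ⟨(IsL2.const x).integrable_inner hX, integral_inner hX.integrable x⟩

theorem integral_toEuclideanLin (hX : Integrable X μ) (M : Matrix (Fin e) (Fin d) ℝ) :
    ∫ ω, M.toEuclideanLin (X ω) ∂μ = M.toEuclideanLin (∫ ω, X ω ∂μ) :=
  M.toEuclideanLin.toContinuousLinearMap.integral_comp_comm hX

theorem integral_sub_integral [IsProbabilityMeasure μ] (hX : Integrable X μ) :
    ∫ ω, (X ω - ∫ ω', X ω' ∂μ) ∂μ = 0 := by
  rw [integral_sub hX (integrable_const _), integral_const, probReal_univ, one_smul, sub_self]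

theorem isL2_of_map (hX : Measurable X) (h : IsP2 (μ.map X)) : IsL2 μ X := by
  refine ⟨hX, hX.aestronglyMeasurable, ?_⟩
  have hfin := h.2
  rw [lintegral_map (by fun_prop) hX] at hfin
  rw [eLpNorm_lt_top_iff_lintegral_rpow_enorm_lt_top (by norm_num) (by norm_num)]
  simpa using hfin

theorem hasExp_inner_of_indepFun [IsProbabilityMeasure μ] {W : Ω → Vec e} (hX : IsL2 μ X)
    (hW : IsL2 μ W) (hind : IndepFun W X μ) (M : Matrix (Fin d) (Fin e) ℝ) :
    HasExp μ (fun ω => inner ℝ (X ω) (M.toEuclideanLin (W ω - ∫ ω', W ω' ∂μ))) 0 := by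
  have hL2 := (hW.sub (IsL2.const (∫ ω', W ω' ∂μ))).toEuclideanLin M
  have hmean : ∫ ω, M.toEuclideanLin (W ω - ∫ ω', W ω' ∂μ) ∂μ = 0 := by
    rw [integral_toEuclideanLin (hW.sub (IsL2.const _)).integrable,
      integral_sub_integral hW.integrable, map_zero]
  have hind' : IndepFun X (fun ω => M.toEuclideanLin (W ω - ∫ ω', W ω' ∂μ)) μ :=
    hind.symm.comp measurable_id
      ((continuous_toEuclideanLin M).measurable.comp (measurable_id.sub_const _))
  refine ⟨hX.integrable_inner hL2, ?_⟩
  have hprod := hind'.integral_bilin hX.integrable hL2.integrable (innerSL ℝ)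
  rw [hmean, map_zero] at hprod
  exact hprod

end L2

section Covariance

variable {d : ℕ} {Ω : Type*} [MeasurableSpace Ω] {μ : Measure Ω} [IsProbabilityMeasure μ]
  {X D : Ω → Vec d} {M : Matrix (Fin d) (Fin d) ℝ}

theorem quad_eq_sum (M : Matrix (Fin d) (Fin d) ℝ) (x : Vec d) :
    quad M x = ∑ i, ∑ j, M i j * (x j * x i) := by
  rw [quad_eq_dotProduct]
  simp only [dotProduct, Matrix.mulVec, star_trivial, Finset.mul_sum]
  exact Finset.sum_congr rfl fun i _ => Finset.sum_congr rfl fun j _ => by ring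

theorem trace_mul_covMatrix (hX : IsL2 μ X) (M : Matrix (Fin d) (Fin d) ℝ) :
    (M * covMatrix μ X).trace = ∫ ω, quad M (X ω - ∫ ω', X ω' ∂μ) ∂μ := by
  have hcenter := hX.sub (IsL2.const (∫ ω', X ω' ∂μ))
  have hmean : ∀ i, (∫ ω, X ω ∂μ) i = ∫ ω, X ω i ∂μ :=
    eval_integral_piLp fun i => (hX.2.eval_piLp i).integrable (by norm_num)
  have hint : ∀ i j, Integrable (fun ω => M i j * ((X ω - ∫ ω', X ω' ∂μ) j *
      (X ω - ∫ ω', X ω' ∂μ) i)) μ := fun i j =>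
    ((hcenter.2.eval_piLp j).integrable_mul (hcenter.2.eval_piLp i)).const_mul _
  simp only [quad_eq_sum]
  rw [integral_finsetSum _ fun i _ => integrable_finsetSum _ fun j _ => hint i j, Matrix.trace]
  refine Finset.sum_congr rfl fun i _ => ?_
  rw [integral_finsetSum _ fun j _ => hint i j, Matrix.diag_apply, Matrix.mul_apply]
  refine Finset.sum_congr rfl fun j _ => ?_
  simp only [integral_const_mul, covMatrix, Matrix.of_apply, covariance, PiLp.sub_apply, hmean]

theorem covMatrix_add_const (hX : IsL2 μ X) (a : Vec d) :
    covMatrix μ (fun ω => X ω + a) = covMatrix μ X := by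
  have hint : ∀ i, Integrable (fun ω => X ω i) μ := fun i =>
    (hX.2.eval_piLp i).integrable (by norm_num)
  ext i j
  simp only [covMatrix, Matrix.of_apply, PiLp.add_apply]
  rw [covariance_add_const_left (hint i), covariance_add_const_right (hint j)]

theorem trace_mul_covMatrix_add_le {y : Ω → Vec d} (hM : M.PosSemidef) (hD : IsL2 μ D)
    (hy : IsL2 μ y) (hmean : ∫ ω, y ω ∂μ = 0) :
    2 * ∫ ω, inner ℝ (D ω) (M.toEuclideanLin (y ω)) ∂μ + (M * covMatrix μ y).trace
      ≤ (M * covMatrix μ fun ω => D ω + y ω).trace := by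
  set m := ∫ ω, D ω ∂μ
  have hmean' : ∫ ω, (D ω + y ω) ∂μ = m := by
    rw [integral_add hD.integrable hy.integrable, hmean, add_zero]
  rw [trace_mul_covMatrix hy, trace_mul_covMatrix (hD.add hy), hmean, hmean']
  simp only [sub_zero]
  have hMm := (hy.toEuclideanLin M).hasExp_const_inner m
  rw [integral_toEuclideanLin hy.integrable, hmean, map_zero, inner_zero_right] at hMm
  have hcross := (hasExp_integral (hD.integrable_inner (hy.toEuclideanLin M))).sub hMm
  rw [sub_zero] at hcross
  refine ((hcross.const_mul 2).add (hasExp_integral (hy.integrable_quad M))).mono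
    (hasExp_integral (((hD.add hy).sub (IsL2.const m)).integrable_quad M)) fun ω => ?_
  have hsplit : D ω + y ω - m = (D ω - m) + y ω := by abel
  rw [hsplit, quad_add_vec hM.isHermitian, ← inner_sub_left]
  linarith [quad_nonneg hM (D ω - m)]

end Covariance

/-! ### The dissipation inequality -/

section Dissipation

variable {n l m : ℕ} {S : Problem n l m} {meanW : Vec m} {xs xt q : Vec n} {us ut : Vec l}
  {P T : Matrix (Fin n) (Fin n) ℝ} {c : ℝ}

/-- The part of the stage cost `ℓ` that does not depend on the covariances, as a function of the
values of state and control. -/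
noncomputable def Problem.runningCost (S : Problem n l m) (x : Vec n) (u : Vec l) : ℝ :=
  quad S.Q₁ x + quad S.R₁ u + inner ℝ S.s x + inner ℝ S.v u + S.c

/-- The integrand of `storage` in the coordinates `D = X - (Xs(k) - x̃)` and
`y = Xs(k) - x̃ - xs`. -/
noncomputable def storageDensity (P T : Matrix (Fin n) (Fin n) ℝ) (q D y : Vec n) : ℝ :=
  quad (P + T) D - quad P (D + y) + inner ℝ q D

theorem storageDensity_eq (hP : P.IsHermitian) (D y : Vec n) :
    storageDensity P T q D y
      = quad T D + inner ℝ q D - 2 * inner ℝ D (P.toEuclideanLin y) - quad P y := by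
  rw [storageDensity, quad_add, quad_add_vec hP]
  ring

theorem quad_add_add_sub_quad_add_add {d : ℕ} {M : Matrix (Fin d) (Fin d) ℝ} (hM : M.IsHermitian)
    (x x' y z : Vec d) :
    quad M (x + y + z) - quad M (x' + y + z) = quad M x - quad M x'
      + inner ℝ ((2 : ℝ) • M.toEuclideanLin z) (x - x')
      + 2 * inner ℝ (x - x') (M.toEuclideanLin y) := by
  simp only [add_assoc, quad_add_vec hM x, quad_add_vec hM x', map_add, inner_add_right,
    inner_sub_left, inner_smul_left, inner_sub_right, real_inner_comm _ (M.toEuclideanLin z),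
    RCLike.conj_to_real]
  ring

theorem runningCost_sub_runningCost (hQ₁ : S.Q₁.IsHermitian) (hR₁ : S.R₁.IsHermitian)
    (D y a : Vec n) (V v b : Vec l) :
    S.runningCost (D + y + a) (V + v + b) - S.runningCost (xt + y + a) (ut + v + b)
      = quad S.Q₁ D - quad S.Q₁ xt + (quad S.R₁ V - quad S.R₁ ut)
        + inner ℝ ((2 : ℝ) • S.Q₁.toEuclideanLin a + S.s) (D - xt)
        + inner ℝ ((2 : ℝ) • S.R₁.toEuclideanLin b + S.v) (V - ut)
        + 2 * inner ℝ (D - xt) (S.Q₁.toEuclideanLin y)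
        + 2 * inner ℝ (V - ut) (S.R₁.toEuclideanLin v) := by
  have hQ := quad_add_add_sub_quad_add_add hQ₁ D xt y a
  have hR := quad_add_add_sub_quad_add_add hR₁ V ut v b
  simp only [Problem.runningCost, inner_add_left, inner_add_right, inner_sub_right] at hQ hR ⊢
  linarith

theorem inner_riccatiMap {A Q : Matrix (Fin n) (Fin n) ℝ} {B : Matrix (Fin n) (Fin l) ℝ}
    {R : Matrix (Fin l) (Fin l) ℝ} (hR : R.PosDef) (hP : P.PosSemidef) (D y : Vec n) (V : Vec l) :
    inner ℝ D ((riccatiMap A B Q R P).toEuclideanLin y) = inner ℝ D (Q.toEuclideanLin y)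
      + inner ℝ V (R.toEuclideanLin ((riccatiGain A B R P).toEuclideanLin y))
      + inner ℝ (A.toEuclideanLin D + B.toEuclideanLin V)
        (P.toEuclideanLin ((A + B * riccatiGain A B R P).toEuclideanLin y)) := by
  have hgain := inner_riccatiGain_add (A := A) (B := B) hR hP y V
  rw [riccatiMap_eq_mul_closedLoop, map_add, LinearMap.add_apply, inner_add_right,
    toEuclideanLin_mul_apply, toEuclideanLin_mul_apply, inner_transpose, inner_add_left]
  linarith

namespace Problem.IsDesign

/-- All terms that couple the deviation `(D, V)` with the stationary fluctuation `y` cancel by the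
Riccati equation. What remains besides the growth of the deterministic cost has mean zero. -/
theorem le_runningCost_sub (h : S.IsDesign meanW xs us P T q xt ut c) (D y w : Vec n)
    (V : Vec l) :
    c * ‖D - xt‖ ^ 2
      + (quad P ((S.A + S.B * S.gain P).toEuclideanLin y + w) - quad P y
        + 2 * inner ℝ (S.A.toEuclideanLin D + S.B.toEuclideanLin V) (P.toEuclideanLin w)
        - 2 * inner ℝ xt (S.Q₁.toEuclideanLin y)
        - 2 * inner ℝ ut (S.R₁.toEuclideanLin ((S.gain P).toEuclideanLin y)))
      ≤ S.runningCost (D + y + xs) (V + (S.gain P).toEuclideanLin y + us)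
        - S.runningCost (xt + y + xs) (ut + (S.gain P).toEuclideanLin y + us)
        + 2 * inner ℝ D (S.Q₂.toEuclideanLin y)
        + 2 * inner ℝ V (S.R₂.toEuclideanLin ((S.gain P).toEuclideanLin y))
        + storageDensity P T q D y
        - storageDensity P T q (S.A.toEuclideanLin D + S.B.toEuclideanLin V)
          ((S.A + S.B * S.gain P).toEuclideanLin y + w) := by
  have hgrowth := h.growth D V
  have hcross := inner_riccatiMap (A := S.A) (B := S.B) (Q := S.Q₁ + S.Q₂) h.posDef_R
    h.posSemidef_P D y V
  rw [h.riccati, map_add, map_add, LinearMap.add_apply, LinearMap.add_apply, inner_add_right,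
    inner_add_right] at hcross
  rw [runningCost_sub_runningCost h.posSemidef_Q₁.isHermitian h.posDef_R₁.isHermitian,
    storageDensity_eq h.posSemidef_P.isHermitian, storageDensity_eq h.posSemidef_P.isHermitian,
    map_add P.toEuclideanLin, inner_add_right _ (P.toEuclideanLin _), inner_sub_left,
    inner_sub_left, S.gain_eq]
  have hV : 0 ≤ c * ‖V - ut‖ ^ 2 := mul_nonneg h.pos.le (sq_nonneg _)
  linarith

end Problem.IsDesign

end Dissipation

section ClosedLoop

variable {n l m : ℕ} {Ω : Type*} [MeasurableSpace Ω] {μ : Measure Ω} {S : Problem n l m}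
  {meanW : Vec m} {xs xt q : Vec n} {us ut : Vec l} {P T : Matrix (Fin n) (Fin n) ℝ} {c : ℝ}

theorem IsL2.integrable_runningCost [IsFiniteMeasure μ] {X : Ω → Vec n} {U : Ω → Vec l}
    (hX : IsL2 μ X) (hU : IsL2 μ U) : Integrable (fun ω => S.runningCost (X ω) (U ω)) μ :=
  ((((hX.integrable_quad _).add (hU.integrable_quad _)).add
    (hX.hasExp_const_inner _).integrable).add (hU.hasExp_const_inner _).integrable).add
    (integrable_const _)

theorem IsL2.integrable_storageDensity [IsFiniteMeasure μ] {D y : Ω → Vec n} (hD : IsL2 μ D)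
    (hy : IsL2 μ y) : Integrable (fun ω => storageDensity P T q (D ω) (y ω)) μ :=
  ((hD.integrable_quad _).sub ((hD.add hy).integrable_quad _)).add
    (hD.hasExp_const_inner _).integrable

variable [IsProbabilityMeasure μ]

/-- The covariance penalties of the two processes differ at least by the cross terms with `Q₂` and
`R₂`, which are what the stage cost lacks in order to close the Riccati equation. -/
theorem integral_runningCost_sub_le_stageCost_sub {D y : Ω → Vec n} {V v : Ω → Vec l}
    (hQ₂ : S.Q₂.PosSemidef) (hR₂ : S.R₂.PosSemidef) (hD : IsL2 μ D) (hy : IsL2 μ y)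
    (hV : IsL2 μ V) (hv : IsL2 μ v) (hy_mean : ∫ ω, y ω ∂μ = 0) (hv_mean : ∫ ω, v ω ∂μ = 0) :
    ∫ ω, S.runningCost (D ω + y ω + xs) (V ω + v ω + us) ∂μ
        - ∫ ω, S.runningCost (xt + y ω + xs) (ut + v ω + us) ∂μ
        + 2 * ∫ ω, inner ℝ (D ω) (S.Q₂.toEuclideanLin (y ω)) ∂μ
        + 2 * ∫ ω, inner ℝ (V ω) (S.R₂.toEuclideanLin (v ω)) ∂μ
      ≤ S.stageCost μ (fun ω => D ω + y ω + xs) (fun ω => V ω + v ω + us)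
        - S.stageCost μ (fun ω => xt + y ω + xs) (fun ω => ut + v ω + us) := by
  have hcov : ∀ {d : ℕ} {Z : Ω → Vec d} (a b : Vec d), IsL2 μ Z →
      covMatrix μ (fun ω => a + Z ω + b) = covMatrix μ Z := fun a b hZ => by
    simp only [add_comm a]
    rw [covMatrix_add_const (hZ.add (IsL2.const a)), covMatrix_add_const hZ]
  have hQ := trace_mul_covMatrix_add_le hQ₂ hD hy hy_mean
  have hR := trace_mul_covMatrix_add_le hR₂ hV hv hv_mean
  simp only [Problem.stageCost, hcov _ _ hy, hcov _ _ hv, covMatrix_add_const (hD.add hy),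
    covMatrix_add_const (hV.add hv), Problem.runningCost]
  linarith

theorem Problem.IsDesign.dissipation_of_closedLoop
    (h : S.IsDesign meanW xs us P T q xt ut c) {D y w : Ω → Vec n} {V : Ω → Vec l}
    (hD : IsL2 μ D) (hy : IsL2 μ y) (hw : IsL2 μ w) (hV : IsL2 μ V) (hmean : ∫ ω, y ω ∂μ = 0)
    (hstationary : ∫ ω, quad P ((S.A + S.B * S.gain P).toEuclideanLin (y ω) + w ω) ∂μ
      = ∫ ω, quad P (y ω) ∂μ)
    (horth : HasExp μ (fun ω => inner ℝ (S.A.toEuclideanLin (D ω) + S.B.toEuclideanLin (V ω))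
      (P.toEuclideanLin (w ω))) 0) :
    c * ∫ ω, ‖D ω - xt‖ ^ 2 ∂μ
      ≤ S.stageCost μ (fun ω => D ω + y ω + xs)
          (fun ω => V ω + (S.gain P).toEuclideanLin (y ω) + us)
        - S.stageCost μ (fun ω => xt + y ω + xs)
          (fun ω => ut + (S.gain P).toEuclideanLin (y ω) + us)
        + ∫ ω, storageDensity P T q (D ω) (y ω) ∂μ
        - ∫ ω, storageDensity P T q (S.A.toEuclideanLin (D ω) + S.B.toEuclideanLin (V ω))
          ((S.A + S.B * S.gain P).toEuclideanLin (y ω) + w ω) ∂μ := by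
  have hv := hy.toEuclideanLin (S.gain P)
  have hy' := (hy.toEuclideanLin (S.A + S.B * S.gain P)).add hw
  have hD' := (hD.toEuclideanLin S.A).add (hV.toEuclideanLin S.B)
  have hv_mean : ∫ ω, (S.gain P).toEuclideanLin (y ω) ∂μ = 0 := by
    rw [integral_toEuclideanLin hy.integrable, hmean, map_zero]
  have hQ_mean := (hy.toEuclideanLin S.Q₁).hasExp_const_inner xt
  rw [integral_toEuclideanLin hy.integrable, hmean, map_zero, inner_zero_right] at hQ_mean
  have hR_mean := (hv.toEuclideanLin S.R₁).hasExp_const_inner ut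
  rw [integral_toEuclideanLin hv.integrable, hv_mean, map_zero, inner_zero_right] at hR_mean
  have lower := ((hasExp_integral (hD.sub (IsL2.const xt)).integrable_norm_sq).const_mul c).add
    (((((⟨hy'.integrable_quad P, hstationary⟩ : HasExp μ _ _).sub
      (hasExp_integral (hy.integrable_quad P))).add (horth.const_mul 2)).sub
      (hQ_mean.const_mul 2)).sub (hR_mean.const_mul 2))
  have cost : ∀ {X : Ω → Vec n} {U : Ω → Vec l}, IsL2 μ X → IsL2 μ U →
      HasExp μ (fun ω => S.runningCost (X ω + y ω + xs)
        (U ω + (S.gain P).toEuclideanLin (y ω) + us)) _ := fun hX hU =>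
    hasExp_integral (((hX.add hy).add (IsL2.const xs)).integrable_runningCost
      ((hU.add hv).add (IsL2.const us)))
  have upper := (((((cost hD hV).sub (cost (IsL2.const xt) (IsL2.const ut))).add
    ((hasExp_integral (hD.integrable_inner (hy.toEuclideanLin S.Q₂))).const_mul 2)).add
    ((hasExp_integral (hV.integrable_inner (hv.toEuclideanLin S.R₂))).const_mul 2)).add
    (hasExp_integral (hD.integrable_storageDensity (P := P) (T := T) (q := q) hy))).sub
    (hasExp_integral (hD'.integrable_storageDensity (P := P) (T := T) (q := q) hy'))
  have hle := lower.mono upper fun ω => h.le_runningCost_sub (D ω) (y ω) (w ω) (V ω)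
  have hcov := integral_runningCost_sub_le_stageCost_sub (xs := xs) (us := us) (xt := xt)
    (ut := ut) h.posSemidef_Q₂ h.posSemidef_R₂ hD hy hV hv hmean hv_mean
  linarith

end ClosedLoop

section Stationary

variable {n l m : ℕ} {Ω : Type*} [MeasurableSpace Ω] {μ : Measure Ω} {S : Problem n l m}
  {W : ℕ → Ω → Vec m} {xs xt q : Vec n} {us ut : Vec l} {P T : Matrix (Fin n) (Fin n) ℝ} {c : ℝ}
  {Xs : ℕ → Ω → Vec n} {Us : ℕ → Ω → Vec l}

theorem IsNoise.integral_eq (hW : IsNoise μ W) (k : ℕ) : ∫ ω, W k ω ∂μ = ∫ ω, W 0 ω ∂μ :=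
  (hW.ident k).integral_eq

namespace Problem

namespace IsStationaryPair

theorem isL2_state (h : S.IsStationaryPair μ W Xs Us) (k : ℕ) : IsL2 μ (Xs k) := by
  obtain ⟨ρ, hρ, hk⟩ := h.law_state
  exact isL2_of_map (h.measurable_state k) (hk k ▸ hρ)

theorem isL2_control (h : S.IsStationaryPair μ W Xs Us) (k : ℕ) : IsL2 μ (Us k) := by
  obtain ⟨ρ, hρ, hk⟩ := h.law_control
  exact isL2_of_map (h.measurable_control k) (hk k ▸ hρ)

theorem identDistrib_state (h : S.IsStationaryPair μ W Xs Us) (j k : ℕ) :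
    IdentDistrib (Xs j) (Xs k) μ μ := by
  obtain ⟨ρ, -, hρ⟩ := h.law_state
  exact ⟨(h.measurable_state j).aemeasurable, (h.measurable_state k).aemeasurable,
    (hρ j).trans (hρ k).symm⟩

theorem identDistrib_centered (h : S.IsStationaryPair μ W Xs Us) (j k : ℕ) :
    IdentDistrib (fun ω => Xs j ω - xt - xs) (fun ω => Xs k ω - xt - xs) μ μ :=
  (h.identDistrib_state j k).comp (u := fun x => x - xt - xs) (by fun_prop)

variable [IsProbabilityMeasure μ]

theorem isL2_centered (h : S.IsStationaryPair μ W Xs Us) (k : ℕ) :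
    IsL2 μ fun ω => Xs k ω - xt - xs :=
  ((h.isL2_state k).sub (IsL2.const xt)).sub (IsL2.const xs)

theorem hasExp_inner_noise (h : S.IsStationaryPair μ W Xs Us) (hW : IsNoise μ W) {k : ℕ}
    {X : Ω → Vec n} {U : Ω → Vec l} (hX : IsL2 μ X) (hU : IsL2 μ U) (hWX : IndepFun (W k) X μ)
    (hWU : IndepFun (W k) U μ) (M : Matrix (Fin n) (Fin n) ℝ) :
    HasExp μ (fun ω => inner ℝ
      (S.A.toEuclideanLin (X ω - (Xs k ω - xt)) + S.B.toEuclideanLin (U ω - (Us k ω - ut)))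
      (M.toEuclideanLin (S.E.toEuclideanLin (W k ω - ∫ ω', W 0 ω' ∂μ)))) 0 := by
  have orth : ∀ {d : ℕ} (L : Matrix (Fin n) (Fin d) ℝ) {Z : Ω → Vec d}, IsL2 μ Z →
      IndepFun (W k) Z μ → HasExp μ (fun ω => inner ℝ (L.toEuclideanLin (Z ω))
        (M.toEuclideanLin (S.E.toEuclideanLin (W k ω - ∫ ω', W 0 ω' ∂μ)))) 0 := by
    intro d L Z hZ hind
    have horth := hasExp_inner_of_indepFun (hZ.toEuclideanLin L) (hW.isL2 k)
      (hind.comp measurable_id (continuous_toEuclideanLin L).measurable) (M * S.E)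
    simpa only [toEuclideanLin_mul_apply, hW.integral_eq k] using horth
  have hA := (orth S.A hX hWX).sub ((orth S.A (h.isL2_state k) (h.indep_state k)).sub
    (orth S.A (IsL2.const xt) (indepFun_const_right _ _)))
  have hB := (orth S.B hU hWU).sub ((orth S.B (h.isL2_control k) (h.indep_control k)).sub
    (orth S.B (IsL2.const ut) (indepFun_const_right _ _)))
  simpa only [map_sub, inner_add_left, inner_sub_left, sub_zero, add_zero] using hA.add hB

end IsStationaryPair

namespace IsDesign

theorem step_sub {meanW : Vec m} (h : S.IsDesign meanW xs us P T q xt ut c)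
    (hst : S.IsStationaryPair μ W Xs Us) (k : ℕ) (X : Ω → Vec n) (U : Ω → Vec l) (ω : Ω) :
    S.step X U (W k) ω - (Xs (k + 1) ω - xt)
      = S.A.toEuclideanLin (X ω - (Xs k ω - xt)) + S.B.toEuclideanLin (U ω - (Us k ω - ut)) := by
  simp only [hst.dynamics k, Problem.step, map_sub]
  linear_combination (norm := module) -h.steady_shift

theorem centered_succ {meanW : Vec m} (h : S.IsDesign meanW xs us P T q xt ut c)
    (hst : S.IsFeedbackStationaryPair μ W P xs xt us ut Xs Us) (k : ℕ) (ω : Ω) :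
    Xs (k + 1) ω - xt - xs = (S.A + S.B * S.gain P).toEuclideanLin (Xs k ω - xt - xs)
      + S.E.toEuclideanLin (W k ω - meanW) := by
  rw [toEuclideanLin_add_mul_apply]
  simp only [hst.1.dynamics k, Problem.step, hst.2 k ω, map_add, map_sub]
  linear_combination (norm := module) h.steady + h.steady_shift

variable [IsProbabilityMeasure μ]

theorem integral_centered (hW : IsNoise μ W)
    (h : S.IsDesign (∫ ω, W 0 ω ∂μ) xs us P T q xt ut c)
    (hst : S.IsFeedbackStationaryPair μ W P xs xt us ut Xs Us) (k : ℕ) :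
    ∫ ω, (Xs k ω - xt - xs) ∂μ = 0 := by
  refine eq_zero_of_fixed_of_lyapunov h.pos h.closedLoop_lyapunov ?_
  have hy : IsL2 μ fun ω => Xs k ω - xt - xs := hst.1.isL2_centered k
  have hnoise : IsL2 μ fun ω => W k ω - ∫ ω', W k ω' ∂μ := (hW.isL2 k).sub (IsL2.const _)
  calc (S.A + S.B * S.gain P).toEuclideanLin (∫ ω, (Xs k ω - xt - xs) ∂μ)
      = ∫ ω, (Xs (k + 1) ω - xt - xs) ∂μ := by
        simp only [h.centered_succ hst k, ← hW.integral_eq k]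
        rw [integral_add (hy.toEuclideanLin _).integrable (hnoise.toEuclideanLin _).integrable,
          integral_toEuclideanLin hy.integrable, integral_toEuclideanLin hnoise.integrable,
          integral_sub_integral (hW.isL2 k).integrable, map_zero, add_zero]
    _ = ∫ ω, (Xs k ω - xt - xs) ∂μ := (hst.1.identDistrib_centered (k + 1) k).integral_eq

end IsDesign

end Problem

theorem storage_eq_integral_storageDensity (k : ℕ) (X : Ω → Vec n) :
    storage μ P T q xs xt Xs k X
      = ∫ ω, storageDensity P T q (X ω - (Xs k ω - xt)) (Xs k ω - xt - xs) ∂μ := by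
  have hsum : ∀ ω, X ω - (Xs k ω - xt) + (Xs k ω - xt - xs) = X ω - xs := fun ω => by abel
  simp only [storage, storageDensity, hsum]

theorem Problem.IsDesign.dissipation [IsProbabilityMeasure μ] (hW : IsNoise μ W)
    (h : S.IsDesign (∫ ω, W 0 ω ∂μ) xs us P T q xt ut c)
    (hst : S.IsFeedbackStationaryPair μ W P xs xt us ut Xs Us) (k : ℕ) {X : Ω → Vec n}
    {U : Ω → Vec l} (hX : IsL2 μ X) (hU : IsL2 μ U) (hWX : IndepFun (W k) X μ)
    (hWU : IndepFun (W k) U μ) :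
    c * ∫ ω, ‖X ω - Xs k ω‖ ^ 2 ∂μ ≤ S.stageCost μ X U - S.stageCost μ (Xs k) (Us k)
      + storage μ P T q xs xt Xs k X - storage μ P T q xs xt Xs (k + 1) (S.step X U (W k)) := by
  have hfb := hst.2 k
  have hD : IsL2 μ fun ω => X ω - (Xs k ω - xt) :=
    hX.sub ((hst.1.isL2_state k).sub (IsL2.const xt))
  have hV : IsL2 μ fun ω => U ω - (Us k ω - ut) :=
    hU.sub ((hst.1.isL2_control k).sub (IsL2.const ut))
  have hw : IsL2 μ fun ω => S.E.toEuclideanLin (W k ω - ∫ ω', W 0 ω' ∂μ) :=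
    ((hW.isL2 k).sub (IsL2.const _)).toEuclideanLin _
  have hstationary : ∫ ω, quad P (Xs (k + 1) ω - xt - xs) ∂μ
      = ∫ ω, quad P (Xs k ω - xt - xs) ∂μ :=
    ((hst.1.identDistrib_centered (k + 1) k).comp (continuous_quad P).measurable).integral_eq
  simp only [h.centered_succ hst k] at hstationary
  have hdiss := h.dissipation_of_closedLoop hD (hst.1.isL2_centered k) hw hV
    (h.integral_centered hW hst k) hstationary (hst.1.hasExp_inner_noise hW hX hU hWX hWU P)
  have hX_eq : (fun ω => X ω - (Xs k ω - xt) + (Xs k ω - xt - xs) + xs) = X := by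
    ext1 ω; abel
  have hU_eq : (fun ω => U ω - (Us k ω - ut)
      + (S.gain P).toEuclideanLin (Xs k ω - xt - xs) + us) = U := by
    ext1 ω; rw [hfb ω]; abel
  have hXs_eq : (fun ω => xt + (Xs k ω - xt - xs) + xs) = Xs k := by
    ext1 ω; abel
  have hUs_eq : (fun ω => ut + (S.gain P).toEuclideanLin (Xs k ω - xt - xs) + us) = Us k := by
    ext1 ω; rw [hfb ω]; abel
  have hdist : ∀ ω, X ω - (Xs k ω - xt) - xt = X ω - Xs k ω := fun ω => by abel
  simp only [hX_eq, hU_eq, hXs_eq, hUs_eq, hdist, ← h.centered_succ hst k, ← h.step_sub hst.1 k,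
    ← storage_eq_integral_storageDensity] at hdiss
  exact hdiss

theorem neg_le_mul_norm_sq_add_inner {F : Type*} [NormedAddCommGroup F] [InnerProductSpace ℝ F]
    {t : ℝ} (ht : 0 < t) (v x : F) : -((4 * t)⁻¹ * ‖v‖ ^ 2) ≤ t * ‖x‖ ^ 2 + inner ℝ v x := by
  have hsquare : (4 * t)⁻¹ * (2 * t * ‖x‖ - ‖v‖) ^ 2
      = t * ‖x‖ ^ 2 - ‖v‖ * ‖x‖ + (4 * t)⁻¹ * ‖v‖ ^ 2 := by
    field_simp
    ring
  have hnonneg : 0 ≤ (4 * t)⁻¹ * (2 * t * ‖x‖ - ‖v‖) ^ 2 := by positivity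
  linarith [neg_le_of_abs_le (abs_real_inner_le_norm v x)]

theorem le_storageDensity (hP : P.IsHermitian) {t : ℝ} (ht : 0 < t)
    (hT : ∀ x, t * ‖x‖ ^ 2 ≤ quad T x) (D y : Vec n) :
    -((4 * t)⁻¹ * ‖q - (2 : ℝ) • P.toEuclideanLin y‖ ^ 2) - quad P y
      ≤ storageDensity P T q D y := by
  have hyoung := neg_le_mul_norm_sq_add_inner ht (q - (2 : ℝ) • P.toEuclideanLin y) D
  rw [inner_sub_left, inner_smul_left, RCLike.conj_to_real,
    real_inner_comm D (P.toEuclideanLin y)] at hyoung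
  rw [storageDensity_eq hP]
  linarith [hT D]

theorem storage_bddBelow [IsProbabilityMeasure μ] (hP : P.IsHermitian) (hT : T.PosDef)
    (hst : S.IsStationaryPair μ W Xs Us) :
    ∃ M : ℝ, ∀ k X, IsL2 μ X → M ≤ storage μ P T q xs xt Xs k X := by
  obtain ⟨t, ht, hTle⟩ := exists_le_quad hT
  let lower : Vec n → ℝ := fun y =>
    -((4 * t)⁻¹ * ‖q - (2 : ℝ) • P.toEuclideanLin y‖ ^ 2) - quad P y
  have hlower : Measurable lower := by
    have hPcont := continuous_toEuclideanLin P
    have hquad := continuous_quad P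
    exact Continuous.measurable (by fun_prop)
  refine ⟨∫ ω, lower (Xs 0 ω - xt - xs) ∂μ, fun k X hX => ?_⟩
  have hy : IsL2 μ fun ω => Xs k ω - xt - xs := hst.isL2_centered k
  have hD : IsL2 μ fun ω => X ω - (Xs k ω - xt) :=
    hX.sub ((hst.isL2_state k).sub (IsL2.const xt))
  have hslope : IsL2 μ fun ω => q - (2 : ℝ) • P.toEuclideanLin (Xs k ω - xt - xs) := by
    have h2P := hy.toEuclideanLin ((2 : ℝ) • P)
    simp only [map_smul, LinearMap.smul_apply] at h2P
    exact (IsL2.const q).sub h2P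
  have hstationary := ((hst.identDistrib_centered (xt := xt) (xs := xs) 0 k).comp
    hlower).integral_eq
  rw [storage_eq_integral_storageDensity]
  exact hstationary.le.trans (integral_mono
    ((hslope.integrable_norm_sq.const_mul _).neg.sub (hy.integrable_quad P))
    (hD.integrable_storageDensity hy) fun ω => le_storageDensity hP ht hTle _ _)

theorem Problem.IsDesign.isStrictlyDissipative [IsProbabilityMeasure μ] (hW : IsNoise μ W)
    (h : S.IsDesign (∫ ω, W 0 ω ∂μ) xs us P T q xt ut c)
    (hst : S.IsFeedbackStationaryPair μ W P xs xt us ut Xs Us) {α : ℝ → ℝ} (hα : IsKInfty α)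
    (hα_le : ∀ r, 0 ≤ r → α r ≤ c * r) :
    S.IsStrictlyDissipative μ W Xs Us (storage μ P T q xs xt Xs) α where
  isKInfty := hα
  bddBelow := storage_bddBelow h.posSemidef_P.isHermitian h.posDef_T hst.1
  ineq k _ _ hX hU hWX hWU := (hα_le _ (integral_nonneg fun _ => sq_nonneg _)).trans
    (h.dissipation hW hst k hX hU hWX hWU)

end Stationary

/-! ### Turnpike in distribution -/

section ComparisonFunctions

variable {α β : ℝ → ℝ}

theorem IsKInfty.nonneg (hα : IsKInfty α) {r : ℝ} (hr : 0 ≤ r) : 0 ≤ α r :=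
  hα.map_zero.symm.le.trans (hα.strictMonoOn.monotoneOn Set.self_mem_Ici hr hr)

theorem IsKInfty.pos (hα : IsKInfty α) {r : ℝ} (hr : 0 < r) : 0 < α r :=
  hα.map_zero.symm.le.trans_lt (hα.strictMonoOn Set.self_mem_Ici hr.le hr)

theorem IsKInfty.exists_lt (hα : IsKInfty α) (M : ℝ) : ∃ r, 0 ≤ r ∧ M < α r := by
  obtain ⟨_, ⟨r, hr, rfl⟩, hM⟩ := not_bddAbove_iff.1 hα.unbounded M
  exact ⟨r, hr, hM⟩

theorem isKInfty_pow {p : ℕ} (hp : p ≠ 0) : IsKInfty fun r => r ^ p where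
  continuousOn := by fun_prop
  strictMonoOn := fun _ hx _ _ hxy => pow_lt_pow_left₀ hxy hx hp
  map_zero := zero_pow hp
  unbounded := not_bddAbove_iff.2 fun M =>
    ⟨_, ⟨|M| + 1, Set.mem_Ici.2 (by positivity), rfl⟩, calc
      M ≤ |M| := le_abs_self M
      _ < |M| + 1 := lt_add_one _
      _ ≤ (|M| + 1) ^ p := le_self_pow₀ (le_add_of_nonneg_left (abs_nonneg M)) hp⟩

theorem IsKInfty.const_mul (hα : IsKInfty α) {c : ℝ} (hc : 0 < c) :
    IsKInfty fun r => c * α r where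
  continuousOn := hα.continuousOn.const_smul c
  strictMonoOn := fun _ hx _ hy hxy => mul_lt_mul_of_pos_left (hα.strictMonoOn hx hy hxy) hc
  map_zero := by rw [hα.map_zero, mul_zero]
  unbounded := not_bddAbove_iff.2 fun M => by
    obtain ⟨r, hr, hM⟩ := hα.exists_lt (M / c)
    exact ⟨_, ⟨r, hr, rfl⟩, (div_lt_iff₀' hc).1 hM⟩

theorem IsKInfty.min (hα : IsKInfty α) (hβ : IsKInfty β) :
    IsKInfty fun r => min (α r) (β r) where
  continuousOn := ContinuousOn.inf hα.continuousOn hβ.continuousOn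
  strictMonoOn := fun _ hx _ hy hxy =>
    min_lt_min (hα.strictMonoOn hx hy hxy) (hβ.strictMonoOn hx hy hxy)
  map_zero := by rw [hα.map_zero, hβ.map_zero, min_self]
  unbounded := not_bddAbove_iff.2 fun M => by
    obtain ⟨r, hr, hαr⟩ := hα.exists_lt M
    obtain ⟨s, hs, hβs⟩ := hβ.exists_lt M
    have hmax : max r s ∈ Set.Ici (0 : ℝ) := hr.trans (le_max_left r s)
    refine ⟨_, ⟨max r s, hmax, rfl⟩, lt_min ?_ ?_⟩
    · exact hαr.trans_le (hα.strictMonoOn.monotoneOn hr hmax (le_max_left r s))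
    · exact hβs.trans_le (hβ.strictMonoOn.monotoneOn hs hmax (le_max_right r s))

end ComparisonFunctions

section Wasserstein

variable {d : ℕ} {Ω : Type*} [MeasurableSpace Ω] {μ : Measure Ω} {X Y : Ω → Vec d}

theorem wasserstein_map_le (hX : Measurable X) (hY : Measurable Y) (p : ℝ≥0∞) :
    wasserstein p (μ.map X) (μ.map Y) ≤ eLpNorm (fun ω => X ω - Y ω) p μ := by
  have hXY : Measurable fun ω => (X ω, Y ω) := hX.prodMk hY
  calc wasserstein p (μ.map X) (μ.map Y)
      ≤ eLpNorm (fun q : Vec d × Vec d => q.1 - q.2) p (μ.map fun ω => (X ω, Y ω)) :=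
        iInf₂_le (μ.map fun ω => (X ω, Y ω))
          ⟨Measure.map_map measurable_fst hXY, Measure.map_map measurable_snd hXY⟩
    _ = eLpNorm (fun ω => X ω - Y ω) p μ :=
        eLpNorm_map_measure (by fun_prop) hXY.aemeasurable

theorem wasserstein_two_map_le (hX : IsL2 μ X) (hY : IsL2 μ Y) {ε : ℝ} (hε : 0 ≤ ε)
    (h : ∫ ω, ‖X ω - Y ω‖ ^ 2 ∂μ ≤ ε ^ 2) :
    wasserstein 2 (μ.map X) (μ.map Y) ≤ ENNReal.ofReal ε := by
  refine (wasserstein_map_le hX.1 hY.1 2).trans ?_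
  rw [(hX.sub hY).2.eLpNorm_eq_integral_rpow_norm (by norm_num) (by norm_num)]
  refine ENNReal.ofReal_le_ofReal ?_
  simp only [ENNReal.toReal_ofNat, Real.rpow_ofNat]
  rw [← one_div, ← Real.sqrt_eq_rpow]
  exact Real.sqrt_le_iff.2 ⟨hε, h⟩

end Wasserstein

section Turnpike

variable {n l m : ℕ} {Ω : Type*} [MeasurableSpace Ω] {μ : Measure Ω} {S : Problem n l m}
  {W : ℕ → Ω → Vec m} {Xs : ℕ → Ω → Vec n} {Us : ℕ → Ω → Vec l}

theorem sub_div_le_ncard_of_sum_le {f : ℕ → ℝ} {p : ℕ → Prop} {N : ℕ} {b B : ℝ} (hb : 0 < b)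
    (hf : ∀ k < N, 0 ≤ f k) (hp : ∀ k < N, ¬ p k → b ≤ f k)
    (hsum : ∑ k ∈ Finset.range N, f k ≤ B) :
    (N : ℝ) - B / b ≤ ({k | k < N ∧ p k}.ncard : ℝ) := by
  classical
  have hncard : {k | k < N ∧ p k}.ncard = ((Finset.range N).filter p).card := by
    rw [← Set.ncard_coe_finset, Finset.coe_filter]
    simp only [Finset.mem_range]
  have hmarkov : ((Finset.range N).filter fun k => ¬ p k).card * b ≤ B := by
    rw [← nsmul_eq_mul]
    calc _ ≤ ∑ k ∈ (Finset.range N).filter fun k => ¬ p k, f k :=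
          Finset.card_nsmul_le_sum _ _ _ fun k hk => by
            rw [Finset.mem_filter, Finset.mem_range] at hk
            exact hp k hk.1 hk.2
      _ ≤ ∑ k ∈ Finset.range N, f k :=
          Finset.sum_le_sum_of_subset_of_nonneg (Finset.filter_subset _ _)
            fun k hk _ => hf k (Finset.mem_range.1 hk)
      _ ≤ B := hsum
  have hcard : (((Finset.range N).filter p).card : ℝ)
      + ((Finset.range N).filter fun k => ¬ p k).card = N := by
    exact_mod_cast (Finset.card_filter_add_card_filter_not p).trans (Finset.card_range N)
  rw [hncard]
  linarith [(le_div_iff₀ hb).2 hmarkov]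

variable [IsProbabilityMeasure μ]

theorem IsL2.step {X : Ω → Vec n} {U : Ω → Vec l} {V : Ω → Vec m} (hX : IsL2 μ X) (hU : IsL2 μ U)
    (hV : IsL2 μ V) : IsL2 μ (S.step X U V) :=
  (((hX.toEuclideanLin _).add (hU.toEuclideanLin _)).add (hV.toEuclideanLin _)).add
    (IsL2.const S.z)

theorem Problem.IsControl.isL2_traj (hW : IsNoise μ W) {X₀ : Ω → Vec n} (hX₀ : IsL2 μ X₀) {N : ℕ}
    {U : ℕ → Ω → Vec l} (hU : S.IsControl μ W N X₀ U) {k : ℕ} (hk : k ≤ N) :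
    IsL2 μ (S.traj W X₀ U k) := by
  induction k with
  | zero => exact hX₀
  | succ k ih => exact (ih (Nat.le_of_succ_le hk)).step (hU.isL2 k hk) (hW.isL2 k)

namespace Problem.IsStrictlyDissipative

variable {lam : ℕ → (Ω → Vec n) → ℝ} {α : ℝ → ℝ}

theorem sum_rate_le (hW : IsNoise μ W) (hd : S.IsStrictlyDissipative μ W Xs Us lam α)
    {X₀ : Ω → Vec n} (hX₀ : IsL2 μ X₀) {N : ℕ} {U : ℕ → Ω → Vec l}
    (hU : S.IsControl μ W N X₀ U) :
    ∑ k ∈ Finset.range N, α (∫ ω, ‖S.traj W X₀ U k ω - Xs k ω‖ ^ 2 ∂μ)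
      ≤ S.totalCost μ W N X₀ U - ∑ k ∈ Finset.range N, S.stageCost μ (Xs k) (Us k)
        + (lam 0 X₀ - lam N (S.traj W X₀ U N)) := by
  rw [totalCost, ← Finset.sum_sub_distrib,
    show lam 0 X₀ = lam 0 (S.traj W X₀ U 0) from rfl,
    ← Finset.sum_range_sub' (fun k => lam k (S.traj W X₀ U k)), ← Finset.sum_add_distrib]
  refine Finset.sum_le_sum fun k hk => ?_
  rw [Finset.mem_range] at hk
  rw [← add_sub_assoc]
  exact hd.ineq k _ _ (hU.isL2_traj hW hX₀ hk.le) (hU.isL2 k hk) (hU.indep_state k hk)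
    (hU.indep_control k hk)

theorem turnpikeInDistribution (hW : IsNoise μ W)
    (hd : S.IsStrictlyDissipative μ W Xs Us lam α) (hst : S.IsStationaryPair μ W Xs Us)
    {β : ℝ → ℝ} (hβ_pos : ∀ ε, 0 < ε → 0 < β ε) (hβ_le : ∀ ε, 0 < ε → β ε ≤ α (ε ^ 2)) :
    S.TurnpikeInDistribution μ W Xs Us β := by
  intro X₀ hX₀
  obtain ⟨M, hM⟩ := hd.bddBelow
  refine ⟨lam 0 X₀ - M, fun δ _ N U hU hJ ε hε => ?_⟩
  have hdist : ∀ k, 0 ≤ ∫ ω, ‖S.traj W X₀ U k ω - Xs k ω‖ ^ 2 ∂μ := fun k =>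
    integral_nonneg fun _ => sq_nonneg _
  refine sub_div_le_ncard_of_sum_le (hβ_pos ε hε)
    (fun k _ => hd.isKInfty.nonneg (hdist k)) (fun k hk hfar => ?_) ?_
  · refine (hβ_le ε hε).trans
      (hd.isKInfty.strictMonoOn.monotoneOn (sq_nonneg ε) (hdist k) ?_)
    contrapose! hfar
    exact wasserstein_two_map_le (hU.isL2_traj hW hX₀ hk.le) (hst.isL2_state k) hε.le hfar.le
  · linarith [hd.sum_rate_le hW hX₀ hU, hM N _ (hU.isL2_traj hW hX₀ le_rfl)]

end Problem.IsStrictlyDissipative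

end Turnpike

/-! ### Existence of stationary pairs -/

section Independence

variable {Ω α β γ : Type*} [MeasurableSpace Ω] {μ : Measure Ω}
  [MeasurableSpace α] [MeasurableSpace β] [MeasurableSpace γ]

theorem indepFun_prodMk_left [IsFiniteMeasure μ] {X : Ω → α} {Y : Ω → β} {Z : Ω → γ}
    (hX : Measurable X) (hY : Measurable Y) (hZ : Measurable Z)
    (hX_YZ : IndepFun X (fun ω => (Y ω, Z ω)) μ) (hYZ : IndepFun Y Z μ) :
    IndepFun (fun ω => (X ω, Y ω)) Z μ := by
  have hXY : IndepFun X Y μ := hX_YZ.comp measurable_id measurable_fst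
  rw [indepFun_iff_map_prod_eq_prod_map_map (hX.prodMk hY).aemeasurable hZ.aemeasurable,
    hXY.map_prod_eq_prod_map_map hX.aemeasurable hY.aemeasurable]
  refine MeasurableEquiv.prodAssoc.map_measurableEquiv_injective ?_
  rw [Measure.prodAssoc_prod, ← hYZ.map_prod_eq_prod_map_map hY.aemeasurable hZ.aemeasurable,
    ← hX_YZ.map_prod_eq_prod_map_map hX.aemeasurable (hY.prodMk hZ).aemeasurable,
    Measure.map_map MeasurableEquiv.prodAssoc.measurable ((hX.prodMk hY).prodMk hZ)]
  rfl

variable {V : ℕ → Ω → α}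

theorem indepFun_tail (hm : ∀ k, Measurable (V k)) (hV : iIndepFun V μ) (k : ℕ) :
    IndepFun (V k) (fun ω j => V (k + 1 + j) ω) μ := by
  have := hV.isProbabilityMeasure
  refine IndepFun.indepFun_process (hm k) (fun j => hm (k + 1 + j)) fun I => ?_
  have hdisj : Disjoint {k} (I.map (addLeftEmbedding (k + 1))) := by
    rw [Finset.disjoint_singleton_left, Finset.mem_map]
    rintro ⟨j, -, hj⟩
    rw [addLeftEmbedding_apply] at hj
    omega
  have hmem : ∀ i : I, k + 1 + i.1 ∈ I.map (addLeftEmbedding (k + 1)) := fun i =>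
    Finset.mem_map_of_mem _ i.2
  exact (hV.indepFun_finset _ _ hdisj hm).comp
    (measurable_pi_apply ⟨k, Finset.mem_singleton_self k⟩)
    (measurable_pi_lambda _ fun i : I => measurable_pi_apply ⟨k + 1 + i.1, hmem i⟩)

theorem identDistrib_shift (hV : iIndepFun V μ) (hident : ∀ k, IdentDistrib (V k) (V 0) μ μ) :
    IdentDistrib (fun ω j => V (j + 1) ω) (fun ω j => V j ω) μ μ :=
  IdentDistrib.pi (fun j => (hident (j + 1)).trans (hident j).symm)
    (hV.precomp (add_left_injective 1)) hV

theorem CarriesIndependentUniform.exists_map_eq {m : ℕ} {W : ℕ → Ω → Vec m}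
    (hu : CarriesIndependentUniform μ W) [StandardBorelSpace α] (ρ : Measure α)
    [IsProbabilityMeasure ρ] :
    ∃ X : Ω → α, Measurable X ∧ μ.map X = ρ ∧ IndepFun X (fun ω k => W k ω) μ := by
  obtain ⟨ξ, hξ, hlaw, hindep⟩ := hu
  have := nonempty_of_isProbabilityMeasure ρ
  obtain ⟨f, hf, rfl⟩ := Measure.exists_measurable_map_eq ρ
  have hproj : Measurable (Set.projIcc (0 : ℝ) 1 zero_le_one) := continuous_projIcc.measurable
  refine ⟨fun ω => f (Set.projIcc 0 1 zero_le_one (ξ ω)), hf.comp (hproj.comp hξ), ?_,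
    hindep.comp (hf.comp hproj) measurable_id⟩
  calc μ.map (fun ω => f (Set.projIcc 0 1 zero_le_one (ξ ω)))
      = ((μ.map ξ).map (Set.projIcc 0 1 zero_le_one)).map f := by
        rw [Measure.map_map hproj hξ, Measure.map_map hf (hproj.comp hξ)]
        rfl
    _ = (volume : Measure unitInterval).map f := by
        rw [hlaw, ← unitInterval.measurePreserving_coe.map_eq,
          Measure.map_map hproj measurable_subtype_coe]
        congr 1
        convert Measure.map_id
        exact funext (Set.projIcc_val zero_le_one)

end Independence

section NoiseChain

variable {Ω α β : Type*} [MeasurableSpace Ω] {μ : Measure Ω} [MeasurableSpace α]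
  [MeasurableSpace β] {F : α → β → α} {X₀ : Ω → α} {W : ℕ → Ω → β}

/-- The random dynamical system `X(k+1) = F(X(k), W(k))` with initial value `X₀`, driven by the
noise `W`. -/
def noiseChain (F : α → β → α) (X₀ : Ω → α) (W : ℕ → Ω → β) : ℕ → Ω → α
  | 0 => X₀
  | k + 1 => fun ω => F (noiseChain F X₀ W k ω) (W k ω)

theorem measurable_noiseChain (hF : Measurable F.uncurry) (hX₀ : Measurable X₀)
    (hm : ∀ k, Measurable (W k)) (k : ℕ) : Measurable (noiseChain F X₀ W k) := by
  induction k with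
  | zero => exact hX₀
  | succ k ih => exact hF.comp (ih.prodMk (hm k))

theorem indepFun_noiseChain_tail (hF : Measurable F.uncurry) (hX₀ : Measurable X₀)
    (hm : ∀ k, Measurable (W k)) (hW : iIndepFun W μ)
    (hX₀W : IndepFun X₀ (fun ω k => W k ω) μ) (k : ℕ) :
    IndepFun (noiseChain F X₀ W k) (fun ω j => W (k + j) ω) μ := by
  have := hW.isProbabilityMeasure
  induction k with
  | zero => simpa only [noiseChain, zero_add] using hX₀W
  | succ k ih =>
    have hsplit : Measurable fun w : ℕ → β => (w 0, fun j => w (1 + j)) := by fun_prop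
    have hpast : IndepFun (noiseChain F X₀ W k) (fun ω => (W k ω, fun j => W (k + 1 + j) ω)) μ := by
      simpa only [Function.comp_def, id, add_zero, ← add_assoc] using
        ih.comp measurable_id hsplit
    exact (indepFun_prodMk_left (measurable_noiseChain hF hX₀ hm k) (hm k)
      (measurable_pi_lambda _ fun j => hm (k + 1 + j)) hpast (indepFun_tail hm hW k)).comp hF
      measurable_id

theorem indepFun_noiseChain (hF : Measurable F.uncurry) (hX₀ : Measurable X₀)
    (hm : ∀ k, Measurable (W k)) (hW : iIndepFun W μ)
    (hX₀W : IndepFun X₀ (fun ω k => W k ω) μ) (k : ℕ) :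
    IndepFun (noiseChain F X₀ W k) (W k) μ :=
  (indepFun_noiseChain_tail hF hX₀ hm hW hX₀W k).comp measurable_id (measurable_pi_apply 0)

theorem identDistrib_noiseChain (hF : Measurable F.uncurry) (hX₀ : Measurable X₀)
    (hm : ∀ k, Measurable (W k)) (hW : iIndepFun W μ) (hident : ∀ k, IdentDistrib (W k) (W 0) μ μ)
    (hX₀W : IndepFun X₀ (fun ω k => W k ω) μ) {Z Z' : Ω → α} (hZ' : IdentDistrib Z' Z μ μ)
    (hZ'W : IndepFun Z' (W 0) μ) (hfix : (fun ω => F (Z' ω) (W 0 ω)) =ᵐ[μ] Z)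
    (hX₀Z : IdentDistrib X₀ Z μ μ) (k : ℕ) : IdentDistrib (noiseChain F X₀ W k) Z μ μ := by
  have := hW.isProbabilityMeasure
  induction k with
  | zero => exact hX₀Z
  | succ k ih =>
    have hpair : IdentDistrib (fun ω => (noiseChain F X₀ W k ω, W k ω))
        (fun ω => (Z' ω, W 0 ω)) μ μ :=
      (ih.trans hZ'.symm).prodMk (hident k) (indepFun_noiseChain hF hX₀ hm hW hX₀W k) hZ'W
    have hstep := hpair.comp hF
    exact hstep.trans (IdentDistrib.of_ae_eq hstep.aemeasurable_snd hfix)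

end NoiseChain

section StationarySeries

variable {Ω E β : Type*} [MeasurableSpace Ω] {μ : Measure Ω} [NormedAddCommGroup E] {p : ℝ≥0∞}

theorem memLp_tsum [CompleteSpace E] [Fact (1 ≤ p)] {ι : Type*} [Countable ι] {f : ι → Ω → E}
    (hf : ∀ i, MemLp (f i) p μ) (hsum : ∑' i, eLpNorm (f i) p μ ≠ ∞) :
    MemLp (fun ω => ∑' i, f i ω) p μ := by
  have hLp : ∑' i, ‖(hf i).toLp (f i)‖ₑ ≠ ∞ := by simpa only [Lp.enorm_toLp] using hsum
  refine (Lp.memLp (∑' i, (hf i).toLp (f i))).ae_eq ?_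
  filter_upwards [Lp.coeFn_tsum hLp, ae_all_iff.2 fun i => (hf i).coeFn_toLp] with ω hω hcoe
  rw [hω]
  exact tsum_congr hcoe

variable [NormedSpace ℝ E]

/-- The series `∑ⱼ Gʲ vⱼ`. For i.i.d. `vⱼ` it is the stationary solution of the recursion
`X ↦ G X + v`. -/
noncomputable def stationarySeries (G : E →L[ℝ] E) (v : ℕ → E) : E :=
  ∑' j, (G ^ j) (v j)

variable {G : E →L[ℝ] E}

theorem stationarySeries_eq_add {v : ℕ → E} (hv : Summable fun j => (G ^ j) (v j))
    (hv' : Summable fun j => (G ^ j) (v (j + 1))) :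
    G (stationarySeries G fun j => v (j + 1)) + v 0 = stationarySeries G v := by
  rw [stationarySeries, stationarySeries, hv.tsum_eq_zero_add, G.map_tsum hv', add_comm]
  simp only [pow_zero, one_apply_eq_self, pow_succ',
    mul_apply_eq_comp]

theorem tsum_eLpNorm_pow_apply_ne_top {V : ℕ → Ω → E} (hG : Summable fun j => ‖G ^ j‖) {C : ℝ≥0∞}
    (hC : C ≠ ∞) (hV : ∀ j, eLpNorm (V j) p μ ≤ C) :
    ∑' j, eLpNorm (fun ω => (G ^ j) (V j ω)) p μ ≠ ∞ := by
  refine ne_top_of_le_ne_top (ENNReal.mul_ne_top hG.tsum_ofReal_ne_top hC) ?_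
  rw [← ENNReal.tsum_mul_right]
  refine ENNReal.tsum_le_tsum fun j => ?_
  exact (eLpNorm_le_mul_eLpNorm_of_ae_le_mul
    (Filter.Eventually.of_forall fun ω => (G ^ j).le_opNorm (V j ω)) p).trans
    (mul_le_mul_right (hV j) _)

variable [CompleteSpace E] [Fact (1 ≤ p)] [MeasurableSpace E] [BorelSpace E]
  [SecondCountableTopology E] [MeasurableSpace β] {W : ℕ → Ω → β}

theorem measurable_stationarySeries (G : E →L[ℝ] E) : Measurable (stationarySeries G) :=
  Measurable.tsum fun j => (G ^ j).measurable.comp (measurable_pi_apply j)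

theorem exists_stationary_solution (hm : ∀ k, Measurable (W k)) (hW : iIndepFun W μ)
    (hident : ∀ k, IdentDistrib (W k) (W 0) μ μ) {φ : β → E} (hφ : Measurable φ)
    (hp : MemLp (fun ω => φ (W 0 ω)) p μ) (hG : Summable fun j => ‖G ^ j‖) :
    ∃ Z Z' : Ω → E, Measurable Z ∧ MemLp Z p μ ∧ IdentDistrib Z' Z μ μ ∧ IndepFun Z' (W 0) μ ∧
      (fun ω => G (Z' ω) + φ (W 0 ω)) =ᵐ[μ] Z := by
  have hident' : ∀ k, IdentDistrib (fun ω => φ (W k ω)) (fun ω => φ (W 0 ω)) μ μ := fun k =>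
    (hident k).comp hφ
  have hLp : ∀ k j, MemLp (fun ω => (G ^ j) (φ (W k ω))) p μ := fun k j =>
    (G ^ j).comp_memLp' ((hident' k).memLp_iff.2 hp)
  have hsum : ∀ g : ℕ → ℕ, ∑' j, eLpNorm (fun ω => (G ^ j) (φ (W (g j) ω))) p μ ≠ ∞ := fun g =>
    tsum_eLpNorm_pow_apply_ne_top hG hp.eLpNorm_ne_top fun j => ((hident' (g j)).eLpNorm_eq p).le
  have hsummable : ∀ g : ℕ → ℕ, ∀ᵐ ω ∂μ, Summable fun j => (G ^ j) (φ (W (g j) ω)) := fun g =>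
    (summable_norm_of_tsum_eLpNorm_ne_top Fact.out
      (fun j => (hLp (g j) j).aestronglyMeasurable) (hsum g)).mono fun _ => Summable.of_norm
  have hψ : Measurable fun w : ℕ → β => stationarySeries G fun j => φ (w j) :=
    (measurable_stationarySeries G).comp
      (measurable_pi_lambda _ fun j => hφ.comp (measurable_pi_apply j))
  have htail : IndepFun (fun ω j => W (j + 1) ω) (W 0) μ := by
    simpa only [zero_add, add_comm 1] using (indepFun_tail hm hW 0).symm
  refine ⟨fun ω => stationarySeries G fun j => φ (W j ω),
    fun ω => stationarySeries G fun j => φ (W (j + 1) ω), hψ.comp (measurable_pi_lambda _ hm),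
    memLp_tsum (fun j => hLp j j) (hsum id), (identDistrib_shift hW hident).comp hψ,
    htail.comp hψ measurable_id, ?_⟩
  filter_upwards [hsummable id, hsummable (· + 1)] with ω hω hω'
  exact stationarySeries_eq_add hω hω'

end StationarySeries

section Existence

variable {n l m : ℕ} {Ω : Type*} [MeasurableSpace Ω] {μ : Measure Ω} [IsProbabilityMeasure μ]
  {S : Problem n l m} {W : ℕ → Ω → Vec m}

theorem IsNoise.exists_stationary_chain (hW : IsNoise μ W) (hu : CarriesIndependentUniform μ W)
    {G : Vec n →L[ℝ] Vec n} (hG : Summable fun j => ‖G ^ j‖) {φ : Vec m → Vec n}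
    (hφ : Measurable φ) (hφW : MemLp (fun ω => φ (W 0 ω)) 2 μ) :
    ∃ X : ℕ → Ω → Vec n, (∀ k, IsL2 μ (X k)) ∧ (∀ k, IndepFun (X k) (W k) μ) ∧
      (∀ k, IdentDistrib (X k) (X 0) μ μ) ∧ ∀ k, X (k + 1) = fun ω => G (X k ω) + φ (W k ω) := by
  have hm : ∀ k, Measurable (W k) := fun k => (hW.isL2 k).1
  obtain ⟨Z, Z', hZ, hZLp, hZ'Z, hZ'W, hfix⟩ :=
    exists_stationary_solution hm hW.indep hW.ident hφ hφW hG
  have := Measure.isProbabilityMeasure_map (μ := μ) hZ.aemeasurable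
  obtain ⟨X₀, hX₀, hlaw, hX₀W⟩ := hu.exists_map_eq (μ.map Z)
  have hF : Measurable (Function.uncurry fun x w => G x + φ w) :=
    (G.measurable.comp measurable_fst).add (hφ.comp measurable_snd)
  have hX₀Z : IdentDistrib X₀ Z μ μ := ⟨hX₀.aemeasurable, hZ.aemeasurable, hlaw⟩
  have hident := identDistrib_noiseChain hF hX₀ hm hW.indep hW.ident hX₀W hZ'Z hZ'W hfix hX₀Z
  exact ⟨noiseChain (fun x w => G x + φ w) X₀ W,
    fun k => ⟨measurable_noiseChain hF hX₀ hm k, (hident k).memLp_iff.2 hZLp⟩,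
    indepFun_noiseChain hF hX₀ hm hW.indep hX₀W, fun k => (hident k).trans (hident 0).symm,
    fun _ => rfl⟩

theorem IsL2.isP2_map {d : ℕ} {X : Ω → Vec d} (hX : IsL2 μ X) : IsP2 (μ.map X) := by
  refine ⟨Measure.isProbabilityMeasure_map hX.1.aemeasurable, ?_⟩
  rw [lintegral_map (by fun_prop) hX.1]
  simpa using
    (eLpNorm_lt_top_iff_lintegral_rpow_enorm_lt_top (by norm_num) (by norm_num)).1 hX.2.2

theorem IsNoise.exists_isStationaryPair (hW : IsNoise μ W) (hu : CarriesIndependentUniform μ W)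
    (K : Matrix (Fin l) (Fin n) ℝ) (b : Vec l)
    (hG : Summable fun j => ‖Matrix.toEuclideanCLM (𝕜 := ℝ) (S.A + S.B * K) ^ j‖) :
    ∃ Xs, S.IsStationaryPair μ W Xs fun k ω => K.toEuclideanLin (Xs k ω) + b := by
  obtain ⟨X, hX, hindep, hident, hX_succ⟩ := hW.exists_stationary_chain hu hG
    (φ := fun w => S.E.toEuclideanLin w + (S.B.toEuclideanLin b + S.z))
    ((continuous_toEuclideanLin S.E).measurable.add_const _)
    (((hW.isL2 0).toEuclideanLin S.E).add (IsL2.const _)).2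
  have hκ : Measurable fun x => K.toEuclideanLin x + b :=
    (continuous_toEuclideanLin K).measurable.add_const b
  have hU : ∀ k, IsL2 μ fun ω => K.toEuclideanLin (X k ω) + b := fun k =>
    ((hX k).toEuclideanLin K).add (IsL2.const b)
  exact ⟨X,
    { measurable_state := fun k => (hX k).1
      measurable_control := fun k => (hU k).1
      indep_state := fun k => (hindep k).symm
      indep_control := fun k => ((hindep k).comp hκ measurable_id).symm
      law_state := ⟨_, (hX 0).isP2_map, fun k => (hident k).map_eq⟩
      law_control := ⟨_, (hU 0).isP2_map, fun k => ((hident k).comp hκ).map_eq⟩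
      dynamics := fun k => by
        rw [hX_succ k]
        ext1 ω
        change (S.A + S.B * K).toEuclideanLin (X k ω) + _ = _
        rw [toEuclideanLin_add_mul_apply, Problem.step, map_add]
        abel }⟩

theorem summable_norm_toEuclideanCLM_pow {G : Matrix (Fin n) (Fin n) ℝ} {a r : ℝ} (ha : 0 ≤ a)
    (hr₀ : 0 ≤ r) (hr₁ : r < 1) (hG : ∀ j x, ‖(G ^ j).toEuclideanLin x‖ ≤ a * r ^ j * ‖x‖) :
    Summable fun j => ‖Matrix.toEuclideanCLM (𝕜 := ℝ) G ^ j‖ := by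
  refine Summable.of_nonneg_of_le (fun j => norm_nonneg _) (fun j => ?_)
    ((summable_geometric_of_lt_one hr₀ hr₁).mul_left a)
  rw [← map_pow]
  exact ContinuousLinearMap.opNorm_le_bound _ (by positivity) (hG j)

theorem Problem.IsDesign.exists_isFeedbackStationaryPair {xs xt q : Vec n} {us ut : Vec l}
    {P T : Matrix (Fin n) (Fin n) ℝ} {c : ℝ} {w : Vec m}
    (h : S.IsDesign w xs us P T q xt ut c) (hW : IsNoise μ W)
    (hu : CarriesIndependentUniform μ W) :
    ∃ Xs Us, S.IsFeedbackStationaryPair μ W P xs xt us ut Xs Us := by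
  obtain ⟨a, r, ha, hr₀, hr₁, hG⟩ := exists_norm_pow_le_of_lyapunov
    (h.posDef_T.posSemidef_add h.posSemidef_P) h.pos h.closedLoop_lyapunov
  obtain ⟨Xs, hXs⟩ := hW.exists_isStationaryPair hu (S.gain P)
    (ut + us - (S.gain P).toEuclideanLin (xt + xs))
    (summable_norm_toEuclideanCLM_pow ha hr₀ hr₁ hG)
  refine ⟨Xs, _, hXs, fun k ω => ?_⟩
  simp only [map_sub, map_add]
  abel

end Existence

end StochLQ

theorem mainTheorem4 {n l m : ℕ} {Ω : Type*} [MeasurableSpace Ω]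
    (μ : MeasureTheory.Measure Ω) [MeasureTheory.IsProbabilityMeasure μ]
    (S : StochLQ.Problem n l m) (W : ℕ → Ω → StochLQ.Vec m) (hW : StochLQ.IsNoise μ W)
    (hstab : StochLQ.IsStabilizable S.A S.B)
    (hQ₁ : S.Q₁.PosSemidef) (hQ₂ : S.Q₂.PosSemidef) (hR₁ : S.R₁.PosDef) (hR₂ : S.R₂.PosSemidef)
    (xs : StochLQ.Vec n) (us : StochLQ.Vec l)
    (hsteady : (1 - S.A).toEuclideanLin xs - S.B.toEuclideanLin us =
      S.E.toEuclideanLin (∫ ω, W 0 ω ∂μ) + S.z)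
    (hdet : StochLQ.IsDetectable S.A (CFC.sqrt S.Q₁)) :
    ∃ (P T : Matrix (Fin n) (Fin n) ℝ) (q xt : StochLQ.Vec n) (ut : StochLQ.Vec l) (α : ℝ → ℝ),
      S.IsRiccatiSolution P ∧ T.PosDef ∧
      (1 - S.A).toEuclideanLin xt - S.B.toEuclideanLin ut = 0 ∧
      (StochLQ.CarriesIndependentUniform μ W →
        ∃ Xs Us, S.IsFeedbackStationaryPair μ W P xs xt us ut Xs Us) ∧
      ∀ Xs Us, S.IsFeedbackStationaryPair μ W P xs xt us ut Xs Us →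
        S.IsStrictlyDissipative μ W Xs Us (StochLQ.storage μ P T q xs xt Xs) α ∧
        S.TurnpikeInDistribution μ W Xs Us (fun ε => α (Real.sqrt ε)) ∧
        ∀ lam α', S.IsStrictlyDissipative μ W Xs Us lam α' →
          S.TurnpikeInDistribution μ W Xs Us (fun ε => α' (ε ^ 2)) := by
  obtain ⟨P, T, q, xt, ut, c, h⟩ := S.exists_isDesign hstab hQ₁ hQ₂ hR₁ hR₂ hsteady hdet
  have hlinear : StochLQ.IsKInfty fun r => c * r := by
    simpa only [pow_one] using (StochLQ.isKInfty_pow one_ne_zero).const_mul h.pos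
  have hα : StochLQ.IsKInfty fun r => min (c * r) (c * r ^ 4) :=
    hlinear.min ((StochLQ.isKInfty_pow four_ne_zero).const_mul h.pos)
  refine ⟨P, T, q, xt, ut, fun r => min (c * r) (c * r ^ 4), h.isRiccatiSolution, h.posDef_T,
    StochLQ.steadyState_iff.2 (by rw [add_zero, h.steady_shift]),
    h.exists_isFeedbackStationaryPair hW, fun Xs Us hst => ⟨?_, ?_, fun lam α' hd => ?_⟩⟩
  · exact h.isStrictlyDissipative hW hst hα fun _ _ => min_le_left _ _
  -- The problem is dissipative with the rate `c r` too, and `c (√ε) ^ 4 = c ε ^ 2`.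
  · have hd := h.isStrictlyDissipative hW hst hlinear fun _ _ => le_rfl
    refine hd.turnpikeInDistribution hW hst.1 (fun ε hε => hα.pos (Real.sqrt_pos.2 hε))
      fun ε hε => (min_le_right _ _).trans_eq ?_
    rw [pow_mul √ε 2 2, Real.sq_sqrt hε.le]
  · exact hd.turnpikeInDistribution hW hst.1 (fun ε hε => hd.isKInfty.pos (sq_pos_of_pos hε))
      fun _ _ => le_rfl
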